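/- Let $G$ be a simply connected solvable unimodular real Lie group of dimension $2n$ with Lie algebra $\mathfrak g$ (unimodular: $\operatorname{Tr}(\operatorname{ad}x)=0$ for all $x\in\mathfrak g$), equipped with a left invariant complex structure $J$, i.e. an almost complex structure commuting with the differentials of left translations and with vanishing Nijenhuis tensor $N_J(X,Y)=[X,Y]+J([JX,Y]+[X,JY])-[JX,JY]$. Let $$\psi:\mathfrak g\to\mathbb R,\qquad \psi(x)=\operatorname{Tr}(J\operatorname{ad}x)-\operatorname{Tr}(\operatorname{ad}(Jx)),$$ and put $\mathfrak h=\ker\psi$. Assume that $\psi\neq0$ and that $\psi([\mathfrak g,\mathfrak g])=0$. Then: (1) $\mathfrak h$ is an ideal of $\mathfrak g$ and there is $e_0\in\mathfrak g$ with $\mathfrak g=\mathbb R e_0\oplus\mathfrak h$, so that $\mathfrak g=\mathbb R e_0\ltimes\mathfrak h$. (2) There is a unique connected normal subgroup $H$ of $G$ with Lie algebra $\mathfrak h$, where the Lie algebra of a subgroup $H$ is $\{X\in\mathfrak g : \exp(sX)\in H \text{ for all } s\in\mathbb R\}$. (3) For every $e_0\in\mathfrak g$ with $\mathfrak g=\mathbb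 R e_0\oplus\mathfrak h$ one has $G=\mathbb R\ltimes H$, where $\mathbb R$ is embedded by $s\mapsto\exp(se_0)$: every $g\in G$ can be written uniquely as $g=\exp(te_0)\,\eta$ with $t\in\mathbb R$ and $\eta\in H$, and the coordinate $t=t(g)$ is a smooth function on $G$. (4) For every such $e_0$, with $t$ the corresponding coordinate of $\mathbb R$, and every left invariant complex valued $(n,0)$-form $\sigma$ on $G$ (that is, $\sigma(\dots,Jv,\dots)=i\,\sigma(\dots,v,\dots)$ in each argument), the form $$\tau=\exp\!\Big(-\tfrac i2\operatorname{Tr}(J\operatorname{ad}e_0)\,t\Big)\,\sigma$$ is a smooth $(n,0)$-form on $G$ and is closed, $d\tau=0$. -/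

import Mathlib

open scoped Manifold ContDiff

noncomputable section

/-- Over `ℝ`, the smoothness `minSmoothness ℝ 3 = 3` is below `∞`; this makes Mathlib's Lie algebra
structure on `GroupLieAlgebra` available for smooth real Lie groups. -/
instance instLEInftyMinSmoothnessRealThree : ENat.LEInfty (minSmoothness ℝ 3) :=
  ⟨by
    rw [minSmoothness_of_isRCLikeNormedField]
    exact ENat.LEInfty.out⟩

section Forms

variable {E : Type*} [NormedAddCommGroup E] [NormedSpace ℝ E]
  {M : Type*} [TopologicalSpace M] [ChartedSpace E M]

variable (E M) in
/-- Complex valued differential `k`-forms on a manifold modelled on `E` (no regularity imposed). -/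
abbrev ComplexForm (k : ℕ) : Type _ :=
  ∀ x : M, (TangentSpace 𝓘(ℝ, E) x) [⋀^Fin k]→L[ℝ] ℂ

/-- The local expression of a form in the preferred chart `φ` around `x`: the pullback of the form
by `φ⁻¹`. It is meaningful on the target of `φ`, an open subset of `E`. -/
def ComplexForm.inChart {k : ℕ} (α : ComplexForm E M k) (x : M) : E → E [⋀^Fin k]→L[ℝ] ℂ :=
  fun y ↦ (α ((extChartAt 𝓘(ℝ, E) x).symm y)).compContinuousLinearMap
    (mfderiv 𝓘(ℝ, E) 𝓘(ℝ, E) (extChartAt 𝓘(ℝ, E) x).symm y)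

/-- A form is smooth if its local expressions are smooth. -/
def ComplexForm.IsSmooth {k : ℕ} (α : ComplexForm E M k) : Prop :=
  ∀ x : M, ContDiffAt ℝ ∞ (α.inChart x) (extChartAt 𝓘(ℝ, E) x x)

/-- The exterior derivative of a form: at `x`, the exterior derivative of the local expression in
the chart around `x`, pulled back to the manifold. -/
def ComplexForm.extDerivative {k : ℕ} (α : ComplexForm E M k) : ComplexForm E M (k + 1) :=
  fun x ↦ (extDeriv (α.inChart x) (extChartAt 𝓘(ℝ, E) x x)).compContinuousLinearMap
    (mfderiv 𝓘(ℝ, E) 𝓘(ℝ, E) (extChartAt 𝓘(ℝ, E) x) x)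

/-- `α` is a form of type `(k, 0)` for the almost complex structure `J`:
`α(v₁, …, J vⱼ, …, vₖ) = i α(v₁, …, vₖ)` for each `j`. -/
def ComplexForm.IsTypeZero {k : ℕ} (α : ComplexForm E M k)
    (J : ∀ x : M, TangentSpace 𝓘(ℝ, E) x →L[ℝ] TangentSpace 𝓘(ℝ, E) x) : Prop :=
  ∀ (x : M) (v : Fin k → TangentSpace 𝓘(ℝ, E) x) (j : Fin k),
    α x (Function.update v j (J x (v j))) = Complex.I * α x v

/-- The Nijenhuis tensor `N_J(X, Y) = [X, Y] + J([JX, Y] + [X, JY]) - [JX, JY]`. -/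
def nijenhuis (J : ∀ x : M, TangentSpace 𝓘(ℝ, E) x →L[ℝ] TangentSpace 𝓘(ℝ, E) x)
    (X Y : ∀ x : M, TangentSpace 𝓘(ℝ, E) x) (x : M) : TangentSpace 𝓘(ℝ, E) x :=
  VectorField.mlieBracket 𝓘(ℝ, E) X Y x
    + J x (VectorField.mlieBracket 𝓘(ℝ, E) (fun y ↦ J y (X y)) Y x
      + VectorField.mlieBracket 𝓘(ℝ, E) X (fun y ↦ J y (Y y)) x)
    - VectorField.mlieBracket 𝓘(ℝ, E) (fun y ↦ J y (X y)) (fun y ↦ J y (Y y)) x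

end Forms

section LieGroups

variable {E : Type*} [NormedAddCommGroup E] [NormedSpace ℝ E]
  {G : Type*} [TopologicalSpace G] [ChartedSpace E G] [Group G]

/-- A form on a Lie group is left invariant if `L_a^* α = α` for every left translation `L_a`. -/
def ComplexForm.IsLeftInvariant {k : ℕ} (α : ComplexForm E G k) : Prop :=
  ∀ a g : G, (α (a * g)).compContinuousLinearMap
    (mfderiv 𝓘(ℝ, E) 𝓘(ℝ, E) (fun x : G ↦ a * x) g) = α g

/-- A left invariant complex structure on a Lie group: an integrable almost complex structure that
commutes with the differentials of the left translations (which also makes it smooth). -/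
structure IsLeftInvariantComplexStructure [LieGroup 𝓘(ℝ, E) ∞ G]
    (J : ∀ g : G, TangentSpace 𝓘(ℝ, E) g →L[ℝ] TangentSpace 𝓘(ℝ, E) g) : Prop where
  sq_eq_neg : ∀ (g : G) (v : TangentSpace 𝓘(ℝ, E) g), J g (J g v) = -v
  left_invariant : ∀ (a g : G) (v : TangentSpace 𝓘(ℝ, E) g),
    mfderiv 𝓘(ℝ, E) 𝓘(ℝ, E) (fun x : G ↦ a * x) g (J g v) =
      J (a * g) (mfderiv 𝓘(ℝ, E) 𝓘(ℝ, E) (fun x : G ↦ a * x) g v)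
  integrable : ∀ X Y : (∀ g : G, TangentSpace 𝓘(ℝ, E) g),
    ContMDiff 𝓘(ℝ, E) 𝓘(ℝ, E).tangent ∞ (fun g ↦ (⟨g, X g⟩ : TangentBundle 𝓘(ℝ, E) G)) →
    ContMDiff 𝓘(ℝ, E) 𝓘(ℝ, E).tangent ∞ (fun g ↦ (⟨g, Y g⟩ : TangentBundle 𝓘(ℝ, E) G)) →
    ∀ g : G, nijenhuis J X Y g = 0

/-- `γ` is the one-parameter subgroup `s ↦ exp(s X)`: a homomorphism `ℝ → G` that is an integral
curve of the left invariant vector field with value `X` at the identity. -/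
structure IsOneParameterSubgroup (γ : ℝ → G) (X : GroupLieAlgebra 𝓘(ℝ, E) G) : Prop where
  map_add : ∀ s u : ℝ, γ (s + u) = γ s * γ u
  isMIntegralCurve : IsMIntegralCurve γ (mulInvariantVectorField (I := 𝓘(ℝ, E)) X)

variable (E) in
/-- The Lie algebra of a subgroup `H`: all `X` with `exp(s X) ∈ H` for every real `s`. -/
def subgroupLieAlgebra (H : Subgroup G) : Set (GroupLieAlgebra 𝓘(ℝ, E) G) :=
  {X | ∃ γ : ℝ → G, IsOneParameterSubgroup γ X ∧ ∀ s, γ s ∈ H}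

variable (E) in
/-- `G = ℝ ⋉ H`, where `ℝ` is embedded in `G` by `γ` and `t` is the resulting coordinate of `ℝ`:
`H` is normal, each `g` is `γ (t g) * η` with `η ∈ H`, the number `s` in `g = γ s * η` is determined
by `g`, and the splitting is smooth (if `γ` is smooth, then the inverse
`g ↦ (t g, (γ (t g))⁻¹ * g)` of `(s, η) ↦ γ s * η` is smooth as well). -/
structure IsSemidirectDecomposition (γ : ℝ → G) (H : Subgroup G) (t : G → ℝ) : Prop where
  normal : H.Normal
  contMDiff_coord : ContMDiff 𝓘(ℝ, E) 𝓘(ℝ, ℝ) ∞ t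
  inv_mul_mem : ∀ g : G, (γ (t g))⁻¹ * g ∈ H
  coord_mul : ∀ (s : ℝ), ∀ η ∈ H, t (γ s * η) = s

variable [LieGroup 𝓘(ℝ, E) ∞ G] [CompleteSpace E]

variable (E G) in
/-- A connected Lie group is unimodular if `Tr (ad x) = 0` for all `x` in its Lie algebra. -/
def IsUnimodularLieGroup : Prop :=
  ∀ x : GroupLieAlgebra 𝓘(ℝ, E) G,
    LinearMap.trace ℝ (GroupLieAlgebra 𝓘(ℝ, E) G)
      (LieAlgebra.ad ℝ (GroupLieAlgebra 𝓘(ℝ, E) G) x) = 0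

/-- `Tr (J ad x)`, as a linear form in `x`, for an endomorphism `J` of the Lie algebra. -/
def traceJad (J : GroupLieAlgebra 𝓘(ℝ, E) G →L[ℝ] GroupLieAlgebra 𝓘(ℝ, E) G) :
    GroupLieAlgebra 𝓘(ℝ, E) G →ₗ[ℝ] ℝ :=
  LinearMap.trace ℝ (GroupLieAlgebra 𝓘(ℝ, E) G)
    ∘ₗ LinearMap.mulLeft ℝ (J : Module.End ℝ (GroupLieAlgebra 𝓘(ℝ, E) G))
    ∘ₗ (LieAlgebra.ad ℝ (GroupLieAlgebra 𝓘(ℝ, E) G) :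
      GroupLieAlgebra 𝓘(ℝ, E) G →ₗ[ℝ] Module.End ℝ (GroupLieAlgebra 𝓘(ℝ, E) G))

/-- The canonical 1-form `ψ(x) = Tr (J ad x) - Tr (ad (J x))` on the Lie algebra. -/
def canonicalForm (J : GroupLieAlgebra 𝓘(ℝ, E) G →L[ℝ] GroupLieAlgebra 𝓘(ℝ, E) G) :
    GroupLieAlgebra 𝓘(ℝ, E) G →ₗ[ℝ] ℝ :=
  traceJad J - LinearMap.trace ℝ (GroupLieAlgebra 𝓘(ℝ, E) G)
    ∘ₗ (LieAlgebra.ad ℝ (GroupLieAlgebra 𝓘(ℝ, E) G) :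
      GroupLieAlgebra 𝓘(ℝ, E) G →ₗ[ℝ] Module.End ℝ (GroupLieAlgebra 𝓘(ℝ, E) G))
    ∘ₗ (J : GroupLieAlgebra 𝓘(ℝ, E) G →ₗ[ℝ] GroupLieAlgebra 𝓘(ℝ, E) G)

end LieGroups

/-- The defining formulas of `Tr (J ad x)` and of the canonical 1-form. -/
theorem canonicalForm_apply {E : Type*} [NormedAddCommGroup E] [NormedSpace ℝ E] [CompleteSpace E]
    {G : Type*} [TopologicalSpace G] [ChartedSpace E G] [Group G] [LieGroup 𝓘(ℝ, E) ∞ G]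
    (J : GroupLieAlgebra 𝓘(ℝ, E) G →L[ℝ] GroupLieAlgebra 𝓘(ℝ, E) G)
    (x : GroupLieAlgebra 𝓘(ℝ, E) G) :
    traceJad J x = LinearMap.trace ℝ (GroupLieAlgebra 𝓘(ℝ, E) G)
        ((J : GroupLieAlgebra 𝓘(ℝ, E) G →ₗ[ℝ] GroupLieAlgebra 𝓘(ℝ, E) G)
          ∘ₗ LieAlgebra.ad ℝ (GroupLieAlgebra 𝓘(ℝ, E) G) x) ∧
      canonicalForm J x = traceJad J x - LinearMap.trace ℝ (GroupLieAlgebra 𝓘(ℝ, E) G)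
        (LieAlgebra.ad ℝ (GroupLieAlgebra 𝓘(ℝ, E) G) (J x)) :=
  ⟨rfl, rfl⟩

end

/-! Since `ψ` kills brackets, the left invariant 1-form with value `ψ` at the identity is closed. On
the simply connected group `G` it therefore has a primitive, which, normalised at `1`, is a smooth
character `Ψ : G → ℝ` with differential `ψ` (`exists_character`). The subgroup sought is `ker Ψ`.
From `Ψ(exp(s X)) = s ψ(X)` follow its Lie algebra, its connectedness and the splitting with
coordinate `t = Ψ / ψ(e₀)`. For uniqueness (`eq_kernel`), `H ∩ ker Ψ` and `exp(ℝ e)`, with `ψ(e) ≠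
0`, generate `G`, whence `ker Ψ ≤ H`; the connected subgroup `Ψ(H)` of `ℝ` is `0` or `ℝ`, and `ℝ`
would put `e` in `ker ψ`.

By unimodularity `Tr(J ad e₀) = ψ(e₀)`, so `τ = exp(-(i/2) Ψ) σ` whatever `e₀` is. On left invariant
fields `dτ` is `exp(-(i/2) Ψ)` times a Chevalley–Eilenberg expression at the identity, and it has `n
+ 1` arguments in complex dimension `n`; hence it suffices to test tuples `(v, Jv, x)`
(`eq_zero_of_forall_cons_cons`). There the type of `σ` kills every term that keeps both `v` and
`Jv`. The bracket terms that remain form the derivation of `σ` by `A = ad(Jv) - J ad v`, which is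
complex linear because the Nijenhuis tensor vanishes. As `σ` is a complex volume form, this is
multiplication by the complex trace `(Tr A - i Tr(JA))/2 = -(ψ(v) + i ψ(Jv))/2`, exactly opposite to
the contribution of `-(i/2) ψ ∧ σ`. -/

noncomputable section

open VectorField

/-! ### Left invariant frames in charts -/

section Frames

variable {E : Type*} [NormedAddCommGroup E] [NormedSpace ℝ E]
  {G : Type*} [TopologicalSpace G] [ChartedSpace E G] [Group G]

/-- The frame of left invariant vector fields, read in the preferred chart around `x`. -/
def invariantFrame (x : G) (y : E) : E →L[ℝ] E :=
  (mfderiv 𝓘(ℝ, E) 𝓘(ℝ, E) (extChartAt 𝓘(ℝ, E) x).symm y).inverse ∘L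
    mfderiv 𝓘(ℝ, E) 𝓘(ℝ, E) (fun h : G ↦ (extChartAt 𝓘(ℝ, E) x).symm y * h) 1

variable [LieGroup 𝓘(ℝ, E) ∞ G]

theorem isInvertible_mfderiv_mul_left (g h : G) :
    (mfderiv 𝓘(ℝ, E) 𝓘(ℝ, E) (fun b : G ↦ g * b) h).IsInvertible := by
  have M : (∞ : ℕ∞ω) ≠ 0 := by simp
  have key : ∀ a b c : G, a * b = 1 → a * (b * c) = c →
      mfderiv 𝓘(ℝ, E) 𝓘(ℝ, E) (fun z : G ↦ a * z) (b * c) ∘L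
        mfderiv 𝓘(ℝ, E) 𝓘(ℝ, E) (fun z : G ↦ b * z) c = ContinuousLinearMap.id ℝ E := by
    intro a b c hab _
    have h1 := mfderiv_comp (I := 𝓘(ℝ, E)) (I' := 𝓘(ℝ, E)) (I'' := 𝓘(ℝ, E)) c
      (f := fun z : G ↦ b * z) (g := fun z : G ↦ a * z)
      ((contMDiff_mul_left (I := 𝓘(ℝ, E)) (n := ∞)).contMDiffAt.mdifferentiableAt M)
      ((contMDiff_mul_left (I := 𝓘(ℝ, E)) (n := ∞)).contMDiffAt.mdifferentiableAt M)
    have h2 : (fun z : G ↦ a * z) ∘ (fun z : G ↦ b * z) = id := by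
      ext z; simp [← mul_assoc, hab]
    rw [h2, mfderiv_id] at h1
    exact h1.symm
  have e1 := key g⁻¹ g h (by simp) (by simp)
  have e2 := key g g⁻¹ (g * h) (by simp) (by simp)
  rw [inv_mul_cancel_left] at e2
  exact ContinuousLinearMap.IsInvertible.of_inverse e2 e1

omit [Group G] [LieGroup 𝓘(ℝ, E) ∞ G] in
theorem isManifold_one_of_infty [IsManifold 𝓘(ℝ, E) ∞ G] : IsManifold 𝓘(ℝ, E) 1 G :=
  .of_le (n := ∞) (by simp)

theorem isInvertible_mfderiv_extChartAt_symm {x : G} {y : E}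
    (hy : y ∈ (extChartAt 𝓘(ℝ, E) x).target) :
    (mfderiv 𝓘(ℝ, E) 𝓘(ℝ, E) (extChartAt 𝓘(ℝ, E) x).symm y).IsInvertible := by
  have : IsManifold 𝓘(ℝ, E) 1 G := isManifold_one_of_infty
  simpa using isInvertible_mfderivWithin_extChartAt_symm (I := 𝓘(ℝ, E)) hy

theorem isInvertible_invariantFrame {x : G} {y : E}
    (hy : y ∈ (extChartAt 𝓘(ℝ, E) x).target) : (invariantFrame x y).IsInvertible :=
  (isInvertible_mfderiv_extChartAt_symm hy).inverse.comp (isInvertible_mfderiv_mul_left _ 1)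

theorem mfderiv_extChartAt_symm_invariantFrame {x : G} {y : E}
    (hy : y ∈ (extChartAt 𝓘(ℝ, E) x).target) (v : GroupLieAlgebra 𝓘(ℝ, E) G) :
    mfderiv 𝓘(ℝ, E) 𝓘(ℝ, E) (extChartAt 𝓘(ℝ, E) x).symm y (invariantFrame x y v) =
      mulInvariantVectorField v ((extChartAt 𝓘(ℝ, E) x).symm y) := by
  exact (isInvertible_mfderiv_extChartAt_symm hy).self_apply_inverse _

/-- The field at `g` is the tangent map of multiplication applied to the zero vector at `g` and `v`
at `1`, a composition of smooth maps. -/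
theorem contMDiff_infty_mulInvariantVectorField (v : GroupLieAlgebra 𝓘(ℝ, E) G) :
    ContMDiff 𝓘(ℝ, E) 𝓘(ℝ, E).tangent ∞
      (fun g : G ↦ (⟨g, mulInvariantVectorField v g⟩ : TangentBundle 𝓘(ℝ, E) G)) := by
  have M : (∞ : ℕ∞ω) ≠ 0 := by simp
  let fg : G → TangentBundle 𝓘(ℝ, E) G := fun g ↦ Bundle.TotalSpace.mk' E g 0
  have sfg : ContMDiff 𝓘(ℝ, E) 𝓘(ℝ, E).tangent ∞ fg := Bundle.contMDiff_zeroSection _ _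
  let fv : G → TangentBundle 𝓘(ℝ, E) G := fun _ ↦ Bundle.TotalSpace.mk' E 1 v
  have sfv : ContMDiff 𝓘(ℝ, E) 𝓘(ℝ, E).tangent ∞ fv := contMDiff_const
  have S₂ := contMDiff_equivTangentBundleProd_symm (I := 𝓘(ℝ, E)) (M := G)
    (I' := 𝓘(ℝ, E)) (M' := G) (n := ∞)
  have S₃ : ContMDiff (𝓘(ℝ, E).prod 𝓘(ℝ, E)).tangent 𝓘(ℝ, E).tangent ∞
      (tangentMap (𝓘(ℝ, E).prod 𝓘(ℝ, E)) 𝓘(ℝ, E) (fun p : G × G ↦ p.1 * p.2)) :=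
    ContMDiff.contMDiff_tangentMap (contMDiff_mul 𝓘(ℝ, E) ∞) (by simp)
  refine ((S₃.comp S₂).comp (sfg.prodMk sfv)).congr fun g ↦ ?_
  have e : mfderiv (𝓘(ℝ, E).prod 𝓘(ℝ, E)) 𝓘(ℝ, E) (fun p : G × G ↦ p.1 * p.2) (g, 1)
      ((0 : E), (v : E)) = (mulInvariantVectorField v g : E) := by
    erw [mfderiv_prod_eq_add_apply ((contMDiff_mul 𝓘(ℝ, E) ∞).mdifferentiableAt M)]
    erw [map_zero, zero_add]
    rfl
  exact Bundle.TotalSpace.ext (mul_one g).symm (heq_of_eq e.symm)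

theorem contMDiffAt_extChartAt_symm_infty {x : G} {y : E}
    (hy : y ∈ (extChartAt 𝓘(ℝ, E) x).target) :
    ContMDiffAt 𝓘(ℝ, E) 𝓘(ℝ, E) ∞ (extChartAt 𝓘(ℝ, E) x).symm y :=
  (contMDiffOn_extChartAt_symm (I := 𝓘(ℝ, E)) x).contMDiffAt
    ((isOpen_extChartAt_target x).mem_nhds hy)

/-- For fixed `v` this is the pullback of a smooth left invariant field by the inverse chart. -/
theorem contDiffAt_invariantFrame_apply [CompleteSpace E] {x : G} {y : E}
    (hy : y ∈ (extChartAt 𝓘(ℝ, E) x).target) (v : E) :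
    ContDiffAt ℝ ∞ (fun z : E ↦ invariantFrame x z v) y := by
  have h := ContMDiffAt.mpullback_vectorField_preimage (n := ∞) (m := ∞)
    (contMDiff_infty_mulInvariantVectorField (G := G) v).contMDiffAt
    (contMDiffAt_extChartAt_symm_infty hy)
    (isInvertible_mfderiv_extChartAt_symm hy) (by simp)
  exact contMDiffAt_vectorSpace_iff_contDiffAt.1 h

theorem contDiffAt_invariantFrame [FiniteDimensional ℝ E] {x : G} {y : E}
    (hy : y ∈ (extChartAt 𝓘(ℝ, E) x).target) :
    ContDiffAt ℝ ∞ (invariantFrame x) y := by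
  have : CompleteSpace E := FiniteDimensional.complete ℝ E
  have h : ContDiffOn ℝ ∞ (invariantFrame x) (extChartAt 𝓘(ℝ, E) x).target :=
    contDiffOn_clm_apply.2 fun v z hz ↦ (contDiffAt_invariantFrame_apply hz v).contDiffWithinAt
  exact h.contDiffAt ((isOpen_extChartAt_target x).mem_nhds hy)

/-- Pullback of vector fields by the inverse chart commutes with brackets, so the frame has the
structure constants of the Lie algebra. -/
theorem lieBracket_invariantFrame [CompleteSpace E] {x : G} {y : E}
    (hy : y ∈ (extChartAt 𝓘(ℝ, E) x).target) (u v : GroupLieAlgebra 𝓘(ℝ, E) G) :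
    lieBracket ℝ (fun z : E ↦ invariantFrame x z u) (fun z : E ↦ invariantFrame x z v) y =
      invariantFrame (E := E) x y (⁅u, v⁆ : GroupLieAlgebra 𝓘(ℝ, E) G) := by
  have h := mpullback_mlieBracket (n := ∞) (I := 𝓘(ℝ, E)) (I' := 𝓘(ℝ, E))
    (f := (extChartAt 𝓘(ℝ, E) x).symm) (x₀ := y)
    (mdifferentiableAt_mulInvariantVectorField u) (mdifferentiableAt_mulInvariantVectorField v)
    (contMDiffAt_extChartAt_symm_infty hy)
    (by rw [minSmoothness_of_isRCLikeNormedField]; exact ENat.LEInfty.out)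
  rw [← mulInvariantVector_mlieBracket] at h
  refine Eq.trans ?_ h.symm
  rw [← lieBracketWithin_univ, ← mlieBracketWithin_univ, mlieBracketWithin_eq_lieBracketWithin]
  rfl

end Frames

/-! ### Local primitives of closed left invariant 1-forms -/

section Primitives

variable {E : Type*} [NormedAddCommGroup E] [NormedSpace ℝ E]
  {G : Type*} [TopologicalSpace G] [ChartedSpace E G] [Group G] [LieGroup 𝓘(ℝ, E) ∞ G]

theorem fderiv_comp_extChartAt_symm_invariantFrame {F : Type*} [NormedAddCommGroup F]
    [NormedSpace ℝ F] {f : G → F} {x : G} {y : E} (hy : y ∈ (extChartAt 𝓘(ℝ, E) x).target)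
    (hf : MDifferentiableAt 𝓘(ℝ, E) 𝓘(ℝ, F) f ((extChartAt 𝓘(ℝ, E) x).symm y))
    (v : GroupLieAlgebra 𝓘(ℝ, E) G) :
    fderiv ℝ (f ∘ (extChartAt 𝓘(ℝ, E) x).symm) y (invariantFrame x y v) =
      mfderiv 𝓘(ℝ, E) 𝓘(ℝ, F) f ((extChartAt 𝓘(ℝ, E) x).symm y)
        (mulInvariantVectorField v ((extChartAt 𝓘(ℝ, E) x).symm y)) := by
  rw [← mfderiv_extChartAt_symm_invariantFrame hy, ← mfderiv_eq_fderiv,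
    mfderiv_comp (I' := 𝓘(ℝ, E)) y hf
      ((contMDiffAt_extChartAt_symm_infty hy).mdifferentiableAt (by simp))]
  rfl

theorem contDiffAt_inverse_invariantFrame [FiniteDimensional ℝ E] {x : G} {y : E}
    (hy : y ∈ (extChartAt 𝓘(ℝ, E) x).target) :
    ContDiffAt ℝ ∞ (fun z : E ↦ (invariantFrame x z).inverse) y := by
  have : CompleteSpace E := FiniteDimensional.complete ℝ E
  exact ContDiffAt.comp y (isInvertible_invariantFrame hy).contDiffAt_map_inverse
    (contDiffAt_invariantFrame hy)

/-- A closed left invariant 1-form, expressed in a chart, has a symmetric derivative. -/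
theorem fderiv_comp_inverse_invariantFrame_symm [FiniteDimensional ℝ E] [CompleteSpace E]
    (ψ : E →L[ℝ] ℝ)
    (hψ : ∀ u v : GroupLieAlgebra 𝓘(ℝ, E) G, ψ (⁅u, v⁆ : GroupLieAlgebra 𝓘(ℝ, E) G) = 0)
    {x : G} {y : E}
    (hy : y ∈ (extChartAt 𝓘(ℝ, E) x).target) (a b : E) :
    fderiv ℝ (fun z ↦ ψ ∘L (invariantFrame x z).inverse) y a b =
      fderiv ℝ (fun z ↦ ψ ∘L (invariantFrame x z).inverse) y b a := by
  set α : E → E →L[ℝ] ℝ := fun z ↦ ψ ∘L (invariantFrame x z).inverse with hα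
  have dα : DifferentiableAt ℝ α y :=
    (contDiffAt_const.clm_comp (contDiffAt_inverse_invariantFrame hy)).differentiableAt (by simp)
  have dF : ∀ v : E, DifferentiableAt ℝ (fun z : E ↦ invariantFrame x z v) y := fun v ↦
    (contDiffAt_invariantFrame_apply hy v).differentiableAt (by simp)
  -- Differentiating the constant `α(F v) = ψ v` trades the derivative of `α` for that of the frame
  -- `F`; antisymmetrising then leaves `α([F u, F v]) = ψ ⁅u, v⁆ = 0`.
  have key : ∀ u v : E, fderiv ℝ α y u (invariantFrame x y v) +
      α y (fderiv ℝ (fun z : E ↦ invariantFrame x z v) y u) = 0 := by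
    intro u v
    have h1 : (fun z ↦ α z (invariantFrame x z v)) =ᶠ[nhds y] fun _ ↦ ψ v := by
      filter_upwards [(isOpen_extChartAt_target x).mem_nhds hy] with z hz
      simp only [hα, ContinuousLinearMap.comp_apply,
        (isInvertible_invariantFrame hz).inverse_apply_self]
    have h2 := h1.fderiv_eq (𝕜 := ℝ)
    rw [fderiv_clm_apply dα (dF v)] at h2
    have h3 := DFunLike.congr_fun h2 u
    simp only [add_apply, ContinuousLinearMap.comp_apply,
      ContinuousLinearMap.flip_apply, fderiv_fun_const, Pi.zero_apply,
      zero_apply] at h3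
    rw [add_comm]
    exact h3
  have main : ∀ u v : GroupLieAlgebra 𝓘(ℝ, E) G,
      fderiv ℝ α y (invariantFrame x y u) (invariantFrame x y v) =
        fderiv ℝ α y (invariantFrame x y v) (invariantFrame x y u) := by
    intro u v
    have e1 := key (invariantFrame x y u) v
    have e2 := key (invariantFrame x y v) u
    have e3 : α y (invariantFrame (E := E) x y (⁅u, v⁆ : GroupLieAlgebra 𝓘(ℝ, E) G)) = 0 :=
      (congrArg ψ ((isInvertible_invariantFrame hy).inverse_apply_self _)).trans (hψ u v)
    rw [← lieBracket_invariantFrame hy, lieBracket, map_sub] at e3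
    linarith
  obtain ⟨u, rfl⟩ := (isInvertible_invariantFrame hy).bijective.2 a
  obtain ⟨v, rfl⟩ := (isInvertible_invariantFrame hy).bijective.2 b
  exact main u v

/-- The Poincaré lemma on a ball inside the target of the chart at `x`, transported back to the
group. -/
theorem exists_local_primitive [FiniteDimensional ℝ E] [CompleteSpace E]
    (ψ : E →L[ℝ] ℝ)
    (hψ : ∀ u v : GroupLieAlgebra 𝓘(ℝ, E) G, ψ (⁅u, v⁆ : GroupLieAlgebra 𝓘(ℝ, E) G) = 0) (x : G) :
    ∃ (U : Set G) (f : G → ℝ), IsOpen U ∧ x ∈ U ∧ ContMDiffOn 𝓘(ℝ, E) 𝓘(ℝ, ℝ) ∞ f U ∧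
      ∀ g ∈ U, ∀ v : GroupLieAlgebra 𝓘(ℝ, E) G,
        mfderiv 𝓘(ℝ, E) 𝓘(ℝ, ℝ) f g (mulInvariantVectorField v g) = ψ v := by
  have : IsManifold 𝓘(ℝ, E) 1 G := isManifold_one_of_infty
  set φ := extChartAt 𝓘(ℝ, E) x with hφ
  obtain ⟨r, hr, hball⟩ := Metric.isOpen_iff.1 (isOpen_extChartAt_target (I := 𝓘(ℝ, E)) x) (φ x)
    (mem_extChartAt_target x)
  have hα : ContDiffOn ℝ ∞ (fun z ↦ ψ ∘L (invariantFrame x z).inverse) (Metric.ball (φ x) r) :=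
    fun z hz ↦ (contDiffAt_const.clm_comp
      (contDiffAt_inverse_invariantFrame (hball hz))).contDiffWithinAt
  obtain ⟨f, hf⟩ := (convex_ball (φ x) r).exists_forall_hasFDerivAt_of_fderiv_symmetric
    Metric.isOpen_ball (hα.differentiableOn (by simp))
    (fun a ha ↦ fderiv_comp_inverse_invariantFrame_symm ψ hψ (hball ha))
  have hfs : ContDiffOn ℝ ∞ f (Metric.ball (φ x) r) := by
    rw [contDiffOn_infty_iff_fderiv_of_isOpen Metric.isOpen_ball]
    exact ⟨fun z hz ↦ (hf z hz).differentiableAt.differentiableWithinAt,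
      hα.congr fun z hz ↦ (hf z hz).fderiv⟩
  have hsm : ContMDiffOn 𝓘(ℝ, E) 𝓘(ℝ, ℝ) ∞ (f ∘ φ) (φ.source ∩ φ ⁻¹' Metric.ball (φ x) r) :=
    hfs.contMDiffOn.comp (by
      have := contMDiffOn_extChartAt (I := 𝓘(ℝ, E)) (n := ∞) (x := x)
      rw [← extChartAt_source 𝓘(ℝ, E)] at this
      exact this.mono Set.inter_subset_left) (fun z hz ↦ hz.2)
  have hop : IsOpen (φ.source ∩ φ ⁻¹' Metric.ball (φ x) r) :=
    (continuousOn_extChartAt x).isOpen_inter_preimage (isOpen_extChartAt_source x)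
      Metric.isOpen_ball
  refine ⟨φ.source ∩ φ ⁻¹' Metric.ball (φ x) r, f ∘ φ, hop,
    ⟨mem_extChartAt_source x, Metric.mem_ball_self hr⟩, hsm, fun g hg v ↦ ?_⟩
  have hy := hball hg.2
  have hg' : φ.symm (φ g) = g := φ.left_inv hg.1
  have hd : MDifferentiableAt 𝓘(ℝ, E) 𝓘(ℝ, ℝ) (f ∘ φ) (φ.symm (φ g)) := by
    rw [hg']
    exact ((hsm g hg).contMDiffAt (hop.mem_nhds hg)).mdifferentiableAt (by simp)
  have h := fderiv_comp_extChartAt_symm_invariantFrame hy hd v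
  rw [← hφ, hg'] at h
  rw [← h]
  have he : (f ∘ φ) ∘ φ.symm =ᶠ[nhds (φ g)] f := by
    filter_upwards [(isOpen_extChartAt_target x).mem_nhds hy] with z hz
    simp [φ.right_inv hz]
  rw [he.fderiv_eq, (hf _ hg.2).fderiv, ContinuousLinearMap.comp_apply]
  exact congrArg ψ ((isInvertible_invariantFrame hy).inverse_apply_self (v : E))

/-- A function with vanishing derivative along the left invariant vector fields is locally
constant. -/
theorem eventually_eq_of_mfderiv_mulInvariantVectorField_eq_zero {f : G → ℝ} {x : G}
    (hf : ∀ᶠ g in nhds x, MDifferentiableAt 𝓘(ℝ, E) 𝓘(ℝ, ℝ) f g ∧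
      ∀ v : GroupLieAlgebra 𝓘(ℝ, E) G,
        mfderiv 𝓘(ℝ, E) 𝓘(ℝ, ℝ) f g (mulInvariantVectorField v g) = 0) :
    ∀ᶠ g in nhds x, f g = f x := by
  set φ := extChartAt 𝓘(ℝ, E) x with hφ
  have h1 : ∀ᶠ y in nhds (φ x), y ∈ φ.target ∧
      MDifferentiableAt 𝓘(ℝ, E) 𝓘(ℝ, ℝ) f (φ.symm y) ∧
      ∀ v : GroupLieAlgebra 𝓘(ℝ, E) G,
        mfderiv 𝓘(ℝ, E) 𝓘(ℝ, ℝ) f (φ.symm y) (mulInvariantVectorField v (φ.symm y)) = 0 := by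
    refine Filter.Eventually.and
      ((isOpen_extChartAt_target x).mem_nhds (mem_extChartAt_target x)) ?_
    have hc : Filter.Tendsto φ.symm (nhds (φ x)) (nhds x) := by
      have := continuousAt_extChartAt_symm (I := 𝓘(ℝ, E)) x
      rwa [ContinuousAt, ← hφ, extChartAt_to_inv] at this
    exact hc.eventually hf
  obtain ⟨r, hr, hball⟩ := Metric.eventually_nhds_iff_ball.1 h1
  have h2 : ∀ y ∈ Metric.ball (φ x) r, HasFDerivAt (f ∘ φ.symm) (0 : E →L[ℝ] ℝ) y := by
    intro y hy
    obtain ⟨hyt, hd, h0⟩ := hball y hy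
    have hd' : DifferentiableAt ℝ (f ∘ φ.symm) y :=
      (hd.comp y ((contMDiffAt_extChartAt_symm_infty hyt).mdifferentiableAt
        (by simp))).differentiableAt
    have : fderiv ℝ (f ∘ φ.symm) y = 0 := by
      ext w
      obtain ⟨v, rfl⟩ := (isInvertible_invariantFrame hyt).bijective.2 w
      exact (fderiv_comp_extChartAt_symm_invariantFrame hyt hd v).trans (h0 v)
    rw [← this]
    exact hd'.hasFDerivAt
  have h3 : ∀ y ∈ Metric.ball (φ x) r, (f ∘ φ.symm) y = (f ∘ φ.symm) (φ x) := fun y hy ↦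
    (convex_ball (φ x) r).is_const_of_fderivWithin_eq_zero (𝕜 := ℝ)
      (fun z hz ↦ (h2 z hz).differentiableAt.differentiableWithinAt)
      (fun z hz ↦ by
        rw [fderivWithin_of_isOpen Metric.isOpen_ball hz, (h2 z hz).fderiv]) hy
      (Metric.mem_ball_self hr)
  filter_upwards [extChartAt_source_mem_nhds (I := 𝓘(ℝ, E)) x,
    (continuousAt_extChartAt (I := 𝓘(ℝ, E)) x).preimage_mem_nhds (Metric.ball_mem_nhds _ hr)]
    with g hg hg'
  have := h3 _ hg'
  rwa [Function.comp_apply, Function.comp_apply, φ.left_inv hg,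
    φ.left_inv (mem_extChartAt_source x)] at this

end Primitives

/-! ### Gluing by covering space theory -/

section Gluing

/-- On a simply connected space, functions given locally up to locally constant functions glue
to a global one. -/
theorem exists_glue_of_locallyConstant_sub {X ι A : Type*} [TopologicalSpace X]
    [SimplyConnectedSpace X] [LocallyPathConnectedSpace X] [AddCommGroup A]
    (U : ι → Set X) (f : ι → X → A) (hU : ∀ i, IsOpen (U i)) (hcov : ∀ x, ∃ i, x ∈ U i)
    (hf : ∀ i j, ∀ x ∈ U i ∩ U j, ∀ᶠ y in nhds x, f i y - f j y = f i x - f j x) :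
    ∃ F : X → A, ∀ i, ∀ x ∈ U i, ∀ᶠ y in nhds x, F y - f i y = F x - f i x := by
  let : TopologicalSpace A := ⊥
  have : DiscreteTopology A := ⟨rfl⟩
  choose idx hidx using hcov
  -- A covering with discrete fibre `A`: its coordinate over `U i` stands for the locally constant
  -- function `F - f i`, so changing index adds a difference of the local functions.
  let Z : FiberBundleCore ι X A :=
    { baseSet := U
      isOpen_baseSet := hU
      indexAt := idx
      mem_baseSet_at := hidx
      coordChange := fun i j x c ↦ c + (f i x - f j x)
      coordChange_self := fun i x _ v ↦ by simp
      continuousOn_coordChange := fun i j ↦ by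
        intro p hp
        refine ContinuousAt.continuousWithinAt ?_
        have h1 := hf i j p.1 hp.1
        have h2 : (fun q : X × A ↦ q.2 + (f i q.1 - f j q.1)) =ᶠ[nhds p]
            fun q ↦ q.2 + (f i p.1 - f j p.1) := by
          filter_upwards [continuousAt_fst.eventually h1] with q hq
          rw [hq]
        refine ContinuousAt.congr ?_ h2.symm
        exact (continuous_of_discreteTopology (f := fun a : A ↦ a + (f i p.1 - f j p.1))
          ).continuousAt.comp continuousAt_snd
      coordChange_comp := fun i j k x _ v ↦ by abel }
  have cov : IsCoveringMap (Bundle.TotalSpace.proj : Bundle.TotalSpace A Z.Fiber → X) :=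
    FiberBundle.isCoveringMap
  obtain ⟨x₀⟩ : Nonempty X := inferInstance
  -- Simple connectedness lifts the identity to the covering, which gives a global section.
  obtain ⟨s, ⟨-, hs⟩, -⟩ := cov.existsUnique_continuousMap_lifts (ContinuousMap.id X) x₀
    (⟨x₀, (0 : A)⟩ : Bundle.TotalSpace A Z.Fiber) rfl
  have hs' : ∀ x, (s x).proj = x := fun x ↦ congrFun hs x
  let c : X → A := fun x ↦ (s x).snd
  refine ⟨fun x ↦ c x + f (idx x) x, fun i x hx ↦ ?_⟩
  have hc : ContinuousAt (fun y ↦ ((Z.localTriv i) (s y)).2) x := by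
    refine ContinuousAt.snd (f := fun y ↦ (Z.localTriv i) (s y)) ?_
    refine ContinuousAt.comp (g := Z.localTriv i) ?_ s.continuous.continuousAt
    refine (Z.localTriv i).continuousAt ?_
    rw [Bundle.Trivialization.mem_source]
    change (s x).proj ∈ U i
    rwa [hs']
  have he : ∀ y, ((Z.localTriv i) (s y)).2 = c y + (f (idx y) y - f i y) := by
    intro y
    rw [FiberBundleCore.localTriv_apply]
    change c y + (f (idx (s y).proj) (s y).proj - f i (s y).proj) = _
    rw [hs']
  have := hc.eventually ((isOpen_discrete {((Z.localTriv i) (s x)).2}).mem_nhds rfl)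
  filter_upwards [this] with y hy
  have hy' : ((Z.localTriv i) (s y)).2 = ((Z.localTriv i) (s x)).2 := hy
  rw [he, he] at hy'
  simp only [add_sub_assoc, hy']

end Gluing

/-! ### Integrating a linear form to a character -/

section Characters

variable {E : Type*} [NormedAddCommGroup E] [NormedSpace ℝ E]
  {G : Type*} [TopologicalSpace G] [ChartedSpace E G] [Group G] [LieGroup 𝓘(ℝ, E) ∞ G]

theorem mfderiv_mul_left_mulInvariantVectorField (g h : G) (v : GroupLieAlgebra 𝓘(ℝ, E) G) :
    mfderiv 𝓘(ℝ, E) 𝓘(ℝ, E) (fun x : G ↦ g * x) h (mulInvariantVectorField v h) =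
      mulInvariantVectorField v (g * h) := by
  have M : (∞ : ℕ∞ω) ≠ 0 := by simp
  have h1 := mfderiv_comp_of_eq (I := 𝓘(ℝ, E)) (I' := 𝓘(ℝ, E)) (I'' := 𝓘(ℝ, E)) (x := (1 : G))
      (f := fun z : G ↦ h * z) (g := fun z : G ↦ g * z) (y := h)
      ((contMDiff_mul_left (I := 𝓘(ℝ, E)) (n := ∞)).contMDiffAt.mdifferentiableAt M)
      ((contMDiff_mul_left (I := 𝓘(ℝ, E)) (n := ∞)).contMDiffAt.mdifferentiableAt M) (mul_one h)
  have h2 : (fun z : G ↦ g * z) ∘ (fun z : G ↦ h * z) = fun z ↦ g * h * z := by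
    ext z; simp [mul_assoc]
  rw [h2, mul_one] at h1
  exact (DFunLike.congr_fun h1 v).symm

/-- A linear form on the Lie algebra which vanishes on brackets integrates to a smooth character of
a simply connected Lie group. -/
theorem exists_character [FiniteDimensional ℝ E] [CompleteSpace E] [SimplyConnectedSpace G]
    (ψ : E →L[ℝ] ℝ)
    (hψ : ∀ u v : GroupLieAlgebra 𝓘(ℝ, E) G, ψ (⁅u, v⁆ : GroupLieAlgebra 𝓘(ℝ, E) G) = 0) :
    ∃ Ψ : G → ℝ, ContMDiff 𝓘(ℝ, E) 𝓘(ℝ, ℝ) ∞ Ψ ∧ (∀ g h, Ψ (g * h) = Ψ g + Ψ h) ∧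
      ∀ (g : G) (v : GroupLieAlgebra 𝓘(ℝ, E) G),
        mfderiv 𝓘(ℝ, E) 𝓘(ℝ, ℝ) Ψ g (mulInvariantVectorField v g) = ψ v := by
  have M : (∞ : ℕ∞ω) ≠ 0 := by simp
  have : LocallyPathConnectedSpace G := ChartedSpace.locallyPathConnectedSpace E G
  choose U f hU hxU hfs hfd using exists_local_primitive (G := G) ψ hψ
  -- Two primitives of the same form differ by a locally constant function; this serves both the
  -- gluing and the multiplicativity.
  have hsub : ∀ (f₁ f₂ : G → ℝ) (x : G),
      (∀ᶠ g in nhds x, MDifferentiableAt 𝓘(ℝ, E) 𝓘(ℝ, ℝ) f₁ g ∧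
        ∀ v : GroupLieAlgebra 𝓘(ℝ, E) G,
          mfderiv 𝓘(ℝ, E) 𝓘(ℝ, ℝ) f₁ g (mulInvariantVectorField v g) = ψ v) →
      (∀ᶠ g in nhds x, MDifferentiableAt 𝓘(ℝ, E) 𝓘(ℝ, ℝ) f₂ g ∧
        ∀ v : GroupLieAlgebra 𝓘(ℝ, E) G,
          mfderiv 𝓘(ℝ, E) 𝓘(ℝ, ℝ) f₂ g (mulInvariantVectorField v g) = ψ v) →
      ∀ᶠ y in nhds x, f₁ y - f₂ y = f₁ x - f₂ x := by
    intro f₁ f₂ x h₁ h₂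
    refine eventually_eq_of_mfderiv_mulInvariantVectorField_eq_zero (E := E)
      (f := fun y ↦ f₁ y - f₂ y) ?_
    filter_upwards [h₁, h₂] with g hg₁ hg₂
    have hd := hg₁.1.hasMFDerivAt.sub hg₂.1.hasMFDerivAt
    refine ⟨hd.mdifferentiableAt, fun v ↦ ?_⟩
    refine (DFunLike.congr_fun hd.mfderiv (mulInvariantVectorField v g)).trans ?_
    exact (congrArg₂ (fun a b : ℝ ↦ a - b) (hg₁.2 v) (hg₂.2 v)).trans (sub_self _)
  have hloc : ∀ i x, x ∈ U i → ∀ᶠ g in nhds x, MDifferentiableAt 𝓘(ℝ, E) 𝓘(ℝ, ℝ) (f i) g ∧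
        ∀ v : GroupLieAlgebra 𝓘(ℝ, E) G,
          mfderiv 𝓘(ℝ, E) 𝓘(ℝ, ℝ) (f i) g (mulInvariantVectorField v g) = ψ v := by
    intro i x hx
    filter_upwards [(hU i).mem_nhds hx] with g hg
    exact ⟨((hfs i g hg).contMDiffAt ((hU i).mem_nhds hg)).mdifferentiableAt M, hfd i g hg⟩
  obtain ⟨F, hF⟩ := exists_glue_of_locallyConstant_sub U f hU (fun x ↦ ⟨x, hxU x⟩)
    (fun i j x hx ↦ hsub _ _ x (hloc i x hx.1) (hloc j x hx.2))
  have hFf : ∀ x, F =ᶠ[nhds x] fun y ↦ f x y + (F x - f x x) := by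
    intro x
    filter_upwards [hF x x (hxU x)] with y hy
    rw [← hy]; ring
  have hFs : ContMDiff 𝓘(ℝ, E) 𝓘(ℝ, ℝ) ∞ F := fun x ↦
    ((((hfs x x (hxU x)).contMDiffAt ((hU x).mem_nhds (hxU x))).add
      contMDiffAt_const)).congr_of_eventuallyEq
      (hFf x)
  have hFd : ∀ (g : G) (v : GroupLieAlgebra 𝓘(ℝ, E) G),
        mfderiv 𝓘(ℝ, E) 𝓘(ℝ, ℝ) F g (mulInvariantVectorField v g) = ψ v := by
    intro g v
    have hd := ((((hfs g g (hxU g)).contMDiffAt ((hU g).mem_nhds (hxU g))).mdifferentiableAt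
      M).hasMFDerivAt.add (hasMFDerivAt_const (F g - f g g) g)).congr_of_eventuallyEq (hFf g)
    refine (DFunLike.congr_fun hd.mfderiv (mulInvariantVectorField v g)).trans ?_
    exact (congrArg (fun a : ℝ ↦ a + 0) (hfd g g (hxU g) v)).trans (add_zero _)
  -- By left invariance every left translate of `F` is a primitive of the same form, so it differs
  -- from `F` by a constant.
  have hFl : ∀ (g h : G), MDifferentiableAt 𝓘(ℝ, E) 𝓘(ℝ, ℝ) (fun z ↦ F (g * z)) h ∧
      ∀ v : GroupLieAlgebra 𝓘(ℝ, E) G,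
        mfderiv 𝓘(ℝ, E) 𝓘(ℝ, ℝ) (fun z ↦ F (g * z)) h (mulInvariantVectorField v h) = ψ v := by
    intro g h
    have hl : MDifferentiableAt 𝓘(ℝ, E) 𝓘(ℝ, E) (fun z : G ↦ g * z) h :=
      (contMDiff_mul_left (I := 𝓘(ℝ, E)) (n := ∞)).contMDiffAt.mdifferentiableAt M
    have hc := (hFs.contMDiffAt.mdifferentiableAt M).hasMFDerivAt.comp h hl.hasMFDerivAt
    refine ⟨hc.mdifferentiableAt, fun v ↦ ?_⟩
    refine (DFunLike.congr_fun hc.mfderiv (mulInvariantVectorField v h)).trans ?_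
    rw [← hFd (g * h) v, ← mfderiv_mul_left_mulInvariantVectorField]
    rfl
  have hconst : ∀ g h, F (g * h) - F h = F (g * 1) - F 1 := by
    intro g h
    have : IsLocallyConstant (fun z ↦ F (g * z) - F z) := by
      rw [IsLocallyConstant.iff_eventually_eq]
      exact fun x ↦ hsub (fun z ↦ F (g * z)) F x (.of_forall fun z ↦ hFl g z)
        (.of_forall fun z ↦ ⟨hFs.contMDiffAt.mdifferentiableAt M, hFd z⟩)
    exact this.apply_eq_of_preconnectedSpace h 1
  refine ⟨fun g ↦ F g - F 1, hFs.sub contMDiff_const, fun g h ↦ ?_, fun g v ↦ ?_⟩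
  · have := hconst g h
    rw [mul_one] at this
    linarith
  · have hd := (hFs.contMDiffAt (x := g).mdifferentiableAt M).hasMFDerivAt.sub
      (hasMFDerivAt_const (F 1) g)
    refine (DFunLike.congr_fun hd.mfderiv (mulInvariantVectorField v g)).trans ?_
    exact (congrArg (fun a : ℝ ↦ a - 0) (hFd g v)).trans (sub_zero _)

end Characters

/-! ### One-parameter subgroups -/

section OneParameterSubgroups

variable {E : Type*} [NormedAddCommGroup E] [NormedSpace ℝ E]
  {G : Type*} [TopologicalSpace G] [ChartedSpace E G] [Group G] [LieGroup 𝓘(ℝ, E) ∞ G]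

theorem comp_smulRight_one_of_eq {F₁ F₂ : Type*} [NormedAddCommGroup F₁] [NormedSpace ℝ F₁]
    [NormedAddCommGroup F₂] [NormedSpace ℝ F₂] {L : F₁ →L[ℝ] F₂} {w : F₁} {w' : F₂}
    (h : L w = w') :
    L ∘L (1 : ℝ →L[ℝ] ℝ).smulRight w = (1 : ℝ →L[ℝ] ℝ).smulRight w' := by
  ext; simp [h]

theorem IsMIntegralCurveOn.mul_left {γ : ℝ → G} {v : GroupLieAlgebra 𝓘(ℝ, E) G} {s : Set ℝ}
    (hγ : IsMIntegralCurveOn γ (mulInvariantVectorField (I := 𝓘(ℝ, E)) v) s) (g : G) :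
    IsMIntegralCurveOn (fun t ↦ g * γ t) (mulInvariantVectorField (I := 𝓘(ℝ, E)) v) s := by
  intro t ht
  have hl : MDifferentiableAt 𝓘(ℝ, E) 𝓘(ℝ, E) (fun z : G ↦ g * z) (γ t) :=
    (contMDiff_mul_left (I := 𝓘(ℝ, E)) (n := ∞)).contMDiffAt.mdifferentiableAt (by simp)
  have h := hl.hasMFDerivAt.comp_hasMFDerivWithinAt t (hγ t ht)
  exact ⟨h.1, h.2.congr_fderiv
    (comp_smulRight_one_of_eq (F₁ := E) (F₂ := E)
      (mfderiv_mul_left_mulInvariantVectorField g (γ t) v))⟩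

/-- Left translating one local integral curve through `1` gives the same existence time `ε` at every
point, so integral curves are global. Uniqueness of integral curves then gives the homomorphism
property. -/
theorem exists_isOneParameterSubgroup [CompleteSpace E] [T2Space G]
    (v : GroupLieAlgebra 𝓘(ℝ, E) G) : ∃ γ : ℝ → G, IsOneParameterSubgroup γ v := by
  have : IsManifold 𝓘(ℝ, E) 1 G := isManifold_one_of_infty
  have hv : ContMDiff 𝓘(ℝ, E) 𝓘(ℝ, E).tangent 1
      (fun g : G ↦ (⟨g, mulInvariantVectorField v g⟩ : TangentBundle 𝓘(ℝ, E) G)) :=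
    (contMDiff_infty_mulInvariantVectorField v).of_le (by simp)
  obtain ⟨γ₀, h0, hγ₀⟩ := exists_isMIntegralCurveAt_of_contMDiffAt_boundaryless 0
    (hv.contMDiffAt (x := (1 : G)))
  obtain ⟨ε, hε, hγ₀⟩ := isMIntegralCurveAt_iff'.1 hγ₀
  rw [Real.ball_eq_Ioo, zero_sub, zero_add] at hγ₀
  obtain ⟨γ, hγ1, hγ⟩ := exists_isMIntegralCurve_of_isMIntegralCurveOn hv hε
    (fun g ↦ ⟨fun t ↦ g * γ₀ t, by simp [h0], hγ₀.mul_left g⟩) (1 : G)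
  refine ⟨γ, fun s u ↦ ?_, hγ⟩
  have h1 : IsMIntegralCurve (γ ∘ (· + s)) (mulInvariantVectorField (I := 𝓘(ℝ, E)) v) :=
    hγ.comp_add s
  have h2 : IsMIntegralCurve (fun t ↦ γ s * γ t) (mulInvariantVectorField (I := 𝓘(ℝ, E)) v) := by
    rw [isMIntegralCurve_iff_isMIntegralCurveOn] at hγ ⊢
    exact hγ.mul_left _
  have h3 := isMIntegralCurve_Ioo_eq_of_contMDiff_boundaryless (t₀ := 0) hv h1 h2
    (by simp [hγ1])
  have := congrFun h3 u
  simpa [add_comm] using this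

omit [LieGroup 𝓘(ℝ, E) ∞ G] in
theorem IsOneParameterSubgroup.map_zero {γ : ℝ → G} {v : GroupLieAlgebra 𝓘(ℝ, E) G}
    (hγ : IsOneParameterSubgroup γ v) : γ 0 = 1 := by
  have := hγ.map_add 0 0
  simpa using this

omit [LieGroup 𝓘(ℝ, E) ∞ G] in
theorem IsOneParameterSubgroup.map_neg {γ : ℝ → G} {v : GroupLieAlgebra 𝓘(ℝ, E) G}
    (hγ : IsOneParameterSubgroup γ v) (s : ℝ) : γ (-s) = (γ s)⁻¹ := by
  rw [eq_inv_iff_mul_eq_one, ← hγ.map_add, neg_add_cancel, hγ.map_zero]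

theorem mfderiv_extChartAt_mulInvariantVectorField {x g : G}
    (hg : g ∈ (extChartAt 𝓘(ℝ, E) x).source) (v : GroupLieAlgebra 𝓘(ℝ, E) G) :
    mfderiv 𝓘(ℝ, E) 𝓘(ℝ, E) (extChartAt 𝓘(ℝ, E) x) g (mulInvariantVectorField v g) =
      invariantFrame x (extChartAt 𝓘(ℝ, E) x g) v := by
  have : IsManifold 𝓘(ℝ, E) 1 G := isManifold_one_of_infty
  have hy := (extChartAt 𝓘(ℝ, E) x).map_source hg
  have h1 := mfderiv_extChartAt_symm_invariantFrame hy v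
  have h2 := mfderiv_extChartAt_comp_mfderivWithin_extChartAt_symm' (I := 𝓘(ℝ, E)) hg
  rw [(extChartAt 𝓘(ℝ, E) x).left_inv hg] at h1
  rw [← h1, ← mfderivWithin_univ (f := (extChartAt 𝓘(ℝ, E) x).symm)]
  rw [ModelWithCorners.range_eq_univ] at h2
  exact DFunLike.congr_fun h2 _

/-- In a chart the derivative of `γ` is the frame evaluated along `γ`, which is continuous. Class
`C¹` suffices for the open mapping argument in `eq_top_of_span_eq_top`. -/
theorem IsMIntegralCurve.contMDiff_one [CompleteSpace E] {γ : ℝ → G}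
    {v : GroupLieAlgebra 𝓘(ℝ, E) G}
    (hγ : IsMIntegralCurve γ (mulInvariantVectorField (I := 𝓘(ℝ, E)) v)) :
    ContMDiff 𝓘(ℝ, ℝ) 𝓘(ℝ, E) 1 γ := by
  intro t
  have : IsManifold 𝓘(ℝ, E) 1 G := isManifold_one_of_infty
  rw [contMDiffAt_iff_target]
  refine ⟨hγ.continuous.continuousAt, ?_⟩
  rw [contMDiffAt_iff_contDiffAt, contDiffAt_one_iff]
  refine ⟨fun s ↦ (1 : ℝ →L[ℝ] ℝ).smulRight
    (invariantFrame (γ t) (extChartAt 𝓘(ℝ, E) (γ t) (γ s)) (v : E)),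
    γ ⁻¹' (extChartAt 𝓘(ℝ, E) (γ t)).source,
    hγ.continuous.continuousAt (extChartAt_source_mem_nhds (γ t)), ?_, ?_⟩
  · intro s hs
    have h1 : ContinuousAt (fun z : E ↦ invariantFrame (γ t) z (v : E))
        (extChartAt 𝓘(ℝ, E) (γ t) (γ s)) :=
      (contDiffAt_invariantFrame_apply ((extChartAt 𝓘(ℝ, E) (γ t)).map_source hs) v).continuousAt
    have h2 : ContinuousAt (fun s ↦ extChartAt 𝓘(ℝ, E) (γ t) (γ s)) s :=
      (continuousAt_extChartAt' hs).comp hγ.continuous.continuousAt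
    have h3 : ContinuousAt (fun s ↦ invariantFrame (γ t) (extChartAt 𝓘(ℝ, E) (γ t) (γ s)) (v : E))
      s := ContinuousAt.comp (g := fun z : E ↦ invariantFrame (γ t) z (v : E)) h1 h2
    exact ((ContinuousLinearMap.smulRightL ℝ ℝ E 1).continuous.continuousAt.comp
      h3).continuousWithinAt
  · intro s hs
    have hd : MDifferentiableAt 𝓘(ℝ, E) 𝓘(ℝ, E) (extChartAt 𝓘(ℝ, E) (γ t)) (γ s) :=
      mdifferentiableAt_extChartAt (by simpa using hs)
    have := (hd.hasMFDerivAt.comp s (hγ s)).hasFDerivAt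
    exact this.congr_fderiv
      (comp_smulRight_one_of_eq (F₁ := E) (F₂ := E)
        (mfderiv_extChartAt_mulInvariantVectorField hs v))

omit [LieGroup 𝓘(ℝ, E) ∞ G] in
theorem character_isOneParameterSubgroup {Ψ : G → ℝ} {ψ : E → ℝ}
    (hΨ : ContMDiff 𝓘(ℝ, E) 𝓘(ℝ, ℝ) ∞ Ψ) (hmul : ∀ g h, Ψ (g * h) = Ψ g + Ψ h)
    (hd : ∀ (g : G) (v : GroupLieAlgebra 𝓘(ℝ, E) G),
      mfderiv 𝓘(ℝ, E) 𝓘(ℝ, ℝ) Ψ g (mulInvariantVectorField v g) = ψ v)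
    {γ : ℝ → G} {v : GroupLieAlgebra 𝓘(ℝ, E) G} (hγ : IsOneParameterSubgroup γ v) (s : ℝ) :
    Ψ (γ s) = s * ψ v := by
  have h1 : ∀ t, HasDerivAt (fun u ↦ Ψ (γ u)) (ψ v) t := by
    intro t
    have := ((hΨ.contMDiffAt.mdifferentiableAt (by simp)).hasMFDerivAt.comp t
      (hγ.isMIntegralCurve t)).hasFDerivAt
    have h' : HasFDerivAt (fun u ↦ Ψ (γ u)) ((1 : ℝ →L[ℝ] ℝ).smulRight (ψ v)) t :=
      this.congr_fderiv (comp_smulRight_one_of_eq (F₁ := E) (F₂ := ℝ) (hd (γ t) v))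
    simpa using h'.hasDerivAt
  have h2 : ∀ t, HasDerivAt (fun u ↦ Ψ (γ u) - u * ψ v) 0 t := fun t ↦
    ((h1 t).sub ((hasDerivAt_id t).mul_const (ψ v))).congr_deriv (by simp)
  have h3 := is_const_of_deriv_eq_zero (fun t ↦ (h2 t).differentiableAt) (fun t ↦ (h2 t).deriv) s 0
  have h4 : Ψ 1 = 0 := by simpa using hmul 1 1
  rw [hγ.map_zero, h4] at h3
  linarith

end OneParameterSubgroups

/-! ### Generating a connected group by one-parameter subgroups -/

section Generation

variable {E : Type*} [NormedAddCommGroup E] [NormedSpace ℝ E]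
  {G : Type*} [TopologicalSpace G] [ChartedSpace E G] [Group G] [LieGroup 𝓘(ℝ, E) ∞ G]

/-- The derivative of a product of two curves through the identity is the sum of the derivatives. -/
theorem hasMFDerivAt_mul_of_eq_one {V : Type*} [NormedAddCommGroup V] [NormedSpace ℝ V]
    {P Q : V → G} {P' Q' : V →L[ℝ] E} {a : V} (hP1 : P a = 1) (hQ1 : Q a = 1)
    (hP : HasMFDerivAt 𝓘(ℝ, V) 𝓘(ℝ, E) P a P') (hQ : HasMFDerivAt 𝓘(ℝ, V) 𝓘(ℝ, E) Q a Q') :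
    HasMFDerivAt 𝓘(ℝ, V) 𝓘(ℝ, E) (fun s ↦ P s * Q s) a (P' + Q' : V →L[ℝ] E) := by
  have hm : MDifferentiableAt (𝓘(ℝ, E).prod 𝓘(ℝ, E)) 𝓘(ℝ, E) (fun p : G × G ↦ p.1 * p.2)
      (P a, Q a) := (contMDiff_mul 𝓘(ℝ, E) ∞).mdifferentiableAt (by simp)
  have hc := hm.hasMFDerivAt.comp a (hP.prodMk hQ)
  refine ⟨hc.1, hc.2.congr_fderiv ?_⟩
  have key : ∀ w₁ w₂ : E, mfderiv (𝓘(ℝ, E).prod 𝓘(ℝ, E)) 𝓘(ℝ, E) (fun p : G × G ↦ p.1 * p.2)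
      (P a, Q a) (w₁, w₂) = (w₁ + w₂ : E) := by
    intro w₁ w₂
    have h1 : mfderiv 𝓘(ℝ, E) 𝓘(ℝ, E) (fun z : G ↦ z * Q a) (P a) w₁ = w₁ := by
      have : (fun z : G ↦ z * Q a) = id := by ext; simp [hQ1]
      rw [this, mfderiv_id]
      rfl
    have h2 : mfderiv 𝓘(ℝ, E) 𝓘(ℝ, E) (fun z : G ↦ P a * z) (Q a) w₂ = w₂ := by
      have : (fun z : G ↦ P a * z) = id := by ext; simp [hP1]
      rw [this, mfderiv_id]
      rfl
    exact (mfderiv_prod_eq_add_apply hm).trans (congrArg₂ (fun a b : E ↦ a + b) h1 h2)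
  ext w
  exact key (P' w) (Q' w)

/-- Canonical coordinates of the second kind: when the `v i` with `i ∈ t` span, the product of the
curves with independent parameters is a submersion at `0` with values in `S`. -/
theorem exists_product_of_oneParameterSubgroups [CompleteSpace E] {ι : Type*} [Fintype ι]
    (S : Subgroup G)
    (γ : ι → ℝ → G) (v : ι → GroupLieAlgebra 𝓘(ℝ, E) G)
    (hγ : ∀ i, IsOneParameterSubgroup (γ i) (v i)) (hS : ∀ i s, γ i s ∈ S) (t : Finset ι) :
    ∃ P : (ι → ℝ) → G, ContMDiff 𝓘(ℝ, ι → ℝ) 𝓘(ℝ, E) 1 P ∧ P 0 = 1 ∧ (∀ s, P s ∈ S) ∧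
      ∃ P' : (ι → ℝ) →L[ℝ] E, (∀ s, P' s = ∑ i ∈ t, s i • (v i : E)) ∧
        HasMFDerivAt 𝓘(ℝ, ι → ℝ) 𝓘(ℝ, E) P 0 P' := by
  classical
  have : LieGroup 𝓘(ℝ, E) 1 G := .of_le (n := ∞) (by simp)
  induction t using Finset.induction_on with
  | empty =>
    refine ⟨fun _ ↦ 1, contMDiff_const, rfl, fun _ ↦ S.one_mem, 0, fun s ↦ by
      rw [Finset.sum_empty]; rfl, hasMFDerivAt_const 1 0⟩
  | insert i t hi ih =>
    obtain ⟨P, hPs, hP1, hPS, P', hPv, hP'⟩ := ih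
    have hp : ContMDiff 𝓘(ℝ, ι → ℝ) 𝓘(ℝ, ℝ) 1 (fun s : ι → ℝ ↦ s i) :=
      (ContinuousLinearMap.proj i : (ι → ℝ) →L[ℝ] ℝ).contDiff.contMDiff
    have hQ : HasMFDerivAt 𝓘(ℝ, ι → ℝ) 𝓘(ℝ, E) (fun s : ι → ℝ ↦ γ i (s i)) 0
        ((ContinuousLinearMap.proj i : (ι → ℝ) →L[ℝ] ℝ).smulRight (v i : E)) := by
      have h1 := (hγ i).isMIntegralCurve 0
      have hpd : HasMFDerivAt 𝓘(ℝ, ι → ℝ) 𝓘(ℝ, ℝ) (fun s : ι → ℝ ↦ s i) 0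
          (ContinuousLinearMap.proj i : (ι → ℝ) →L[ℝ] ℝ) :=
        (ContinuousLinearMap.proj i : (ι → ℝ) →L[ℝ] ℝ).hasMFDerivAt
      have hc := HasMFDerivAt.comp (0 : ι → ℝ) (f := fun s : ι → ℝ ↦ s i) h1 hpd
      refine ⟨hc.1, hc.2.congr_fderiv ?_⟩
      have hv : (mulInvariantVectorField (v i) (γ i 0) : E) = v i := by
        rw [(hγ i).map_zero]
        have : (fun z : G ↦ 1 * z) = id := by ext; simp
        rw [mulInvariantVectorField, this, mfderiv_id]
        rfl
      ext w
      exact congrArg (fun z : E ↦ (w i) • z) hv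
    refine ⟨fun s ↦ P s * γ i (s i), hPs.mul ((hγ i).isMIntegralCurve.contMDiff_one.comp hp),
      by simp [hP1, (hγ i).map_zero], fun s ↦ S.mul_mem (hPS s) (hS i _), _, fun s ↦ ?_,
      hasMFDerivAt_mul_of_eq_one hP1 (hγ i).map_zero hP' hQ⟩
    rw [Finset.sum_insert hi, add_comm]
    let w : E := v i
    exact congrArg (fun z : E ↦ z + s i • w) (hPv s)

/-- A subgroup of a connected Lie group which contains enough one-parameter subgroups to span the
Lie algebra is the whole group. -/
theorem eq_top_of_span_eq_top [FiniteDimensional ℝ E] [ConnectedSpace G] (S : Subgroup G)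
    (hS : Submodule.span ℝ (subgroupLieAlgebra E S) = ⊤) : S = ⊤ := by
  have : CompleteSpace E := FiniteDimensional.complete ℝ E
  have : IsManifold 𝓘(ℝ, E) 1 G := isManifold_one_of_infty
  have : IsTopologicalGroup G := topologicalGroup_of_lieGroup 𝓘(ℝ, E) ∞
  let b := Module.Basis.ofSpan (K := ℝ) (V := GroupLieAlgebra 𝓘(ℝ, E) G) hS.ge
  have : FiniteDimensional ℝ (GroupLieAlgebra 𝓘(ℝ, E) G) := inferInstanceAs (FiniteDimensional ℝ E)
  have hfin := Module.Finite.finite_basis b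
  have := Fintype.ofFinite
    ((linearIndepOn_empty ℝ id).extend (Set.empty_subset (subgroupLieAlgebra E S)))
  have hb : ∀ i, b i ∈ subgroupLieAlgebra E S := fun i ↦
    Module.Basis.ofSpan_subset hS.ge ⟨i, rfl⟩
  choose γ hγ hγS using hb
  obtain ⟨P, hPs, hP1, hPS, P', hPv, hP'⟩ :=
    exists_product_of_oneParameterSubgroups S γ (fun i ↦ b i) hγ hγS Finset.univ
  set φ := extChartAt 𝓘(ℝ, E) (1 : G) with hφ
  have hφd : MDifferentiableAt 𝓘(ℝ, E) 𝓘(ℝ, E) φ (P 0) := by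
    rw [hP1]; exact mdifferentiableAt_extChartAt (by simp)
  have hcd : ContDiffAt ℝ 1 (φ ∘ P) 0 := by
    have h := (contMDiffAt_iff_target.1 (hPs 0)).2
    rw [hP1] at h
    exact contMDiffAt_iff_contDiffAt.1 h
  have hder := (hφd.hasMFDerivAt.comp 0 hP').hasFDerivAt
  have hstrict := hcd.hasStrictFDerivAt' hder one_ne_zero
  -- The derivative at `0` is onto because the `b i` form a basis, so the image of the product map,
  -- contained in `S`, is a neighbourhood of `1`.
  have hmap := hstrict.map_nhds_eq_of_surj (by
    rw [LinearMap.range_eq_top]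
    have h1 : Function.Surjective (mfderiv 𝓘(ℝ, E) 𝓘(ℝ, E) φ (P 0)) := by
      rw [hP1]
      exact (isInvertible_mfderiv_extChartAt (I := 𝓘(ℝ, E))
        (mem_extChartAt_source (1 : G))).bijective.2
    have h2 : Function.Surjective P' := fun w ↦
      ⟨b.repr w, (hPv _).trans (b.sum_repr w)⟩
    exact h1.comp h2)
  have hev : ∀ᶠ y in nhds (φ 1), φ.symm y ∈ S := by
    have : φ 1 = (φ ∘ P) 0 := by simp [hP1]
    rw [this, ← hmap, Filter.eventually_map]
    have hsrc : ∀ᶠ s in nhds 0, P s ∈ φ.source := by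
      refine hPs.continuous.continuousAt.eventually ?_
      rw [hP1]
      exact extChartAt_source_mem_nhds 1
    filter_upwards [hsrc] with s hs
    rw [Function.comp_apply, φ.left_inv hs]
    exact hPS s
  have hnhds : (S : Set G) ∈ nhds 1 := by
    filter_upwards [(continuousAt_extChartAt (I := 𝓘(ℝ, E)) (1 : G)).eventually hev,
      extChartAt_source_mem_nhds (I := 𝓘(ℝ, E)) (1 : G)] with g hg hgs
    rwa [← hφ, φ.left_inv hgs] at hg
  have hopen : IsOpen (S : Set G) := S.isOpen_of_mem_nhds hnhds
  have := IsClopen.eq_univ ⟨S.isClosed_of_isOpen hopen, hopen⟩ ⟨1, S.one_mem⟩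
  exact SetLike.coe_injective this

end Generation

/-! ### The kernel of a character and the splitting of the group -/

section Splitting

variable {E : Type*} [NormedAddCommGroup E] [NormedSpace ℝ E]
  {G : Type*} [TopologicalSpace G] [ChartedSpace E G] [Group G]

/-- `Ψ` is a smooth character of the Lie group `G`, with differential `ψ`. -/
structure IsSmoothCharacter (Ψ : G → ℝ) (ψ : GroupLieAlgebra 𝓘(ℝ, E) G →ₗ[ℝ] ℝ) : Prop where
  contMDiff : ContMDiff 𝓘(ℝ, E) 𝓘(ℝ, ℝ) ∞ Ψ
  map_mul : ∀ g h, Ψ (g * h) = Ψ g + Ψ h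
  mfderiv_eq : ∀ (g : G) (v : GroupLieAlgebra 𝓘(ℝ, E) G),
    mfderiv 𝓘(ℝ, E) 𝓘(ℝ, ℝ) Ψ g (mulInvariantVectorField v g) = ψ v

namespace IsSmoothCharacter

variable {Ψ : G → ℝ} {ψ : GroupLieAlgebra 𝓘(ℝ, E) G →ₗ[ℝ] ℝ}

theorem map_one (h : IsSmoothCharacter Ψ ψ) : Ψ 1 = 0 := by
  simpa using h.map_mul 1 1

theorem map_inv (h : IsSmoothCharacter Ψ ψ) (g : G) : Ψ g⁻¹ = -Ψ g := by
  have := h.map_mul g⁻¹ g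
  rw [inv_mul_cancel, h.map_one] at this
  linarith

theorem apply_oneParameterSubgroup (h : IsSmoothCharacter Ψ ψ) {γ : ℝ → G}
    {v : GroupLieAlgebra 𝓘(ℝ, E) G} (hγ : IsOneParameterSubgroup γ v) (s : ℝ) :
    Ψ (γ s) = s * ψ v :=
  character_isOneParameterSubgroup h.contMDiff h.map_mul h.mfderiv_eq hγ s

/-- The kernel of a smooth character. -/
def kernel (h : IsSmoothCharacter Ψ ψ) : Subgroup G where
  carrier := {g | Ψ g = 0}
  one_mem' := h.map_one
  mul_mem' := fun {a b} (ha : Ψ a = 0) (hb : Ψ b = 0) ↦ by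
    change Ψ (a * b) = 0
    rw [h.map_mul, ha, hb, add_zero]
  inv_mem' := fun {a} (ha : Ψ a = 0) ↦ by
    change Ψ a⁻¹ = 0
    rw [h.map_inv, ha, neg_zero]

theorem mem_kernel (h : IsSmoothCharacter Ψ ψ) {g : G} : g ∈ h.kernel ↔ Ψ g = 0 := Iff.rfl

theorem normal_kernel (h : IsSmoothCharacter Ψ ψ) : h.kernel.Normal :=
  ⟨fun k hk g ↦ by
    rw [mem_kernel] at hk ⊢
    rw [h.map_mul, h.map_mul, h.map_inv, hk]
    ring⟩

variable [LieGroup 𝓘(ℝ, E) ∞ G]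

theorem subgroupLieAlgebra_kernel [CompleteSpace E] [T2Space G] (h : IsSmoothCharacter Ψ ψ) :
    subgroupLieAlgebra E h.kernel = (ψ.ker : Set (GroupLieAlgebra 𝓘(ℝ, E) G)) := by
  ext v
  constructor
  · rintro ⟨γ, hγ, hK⟩
    have h1 := h.apply_oneParameterSubgroup hγ 1
    rw [h.mem_kernel.1 (hK 1), one_mul] at h1
    exact LinearMap.mem_ker.2 h1.symm
  · intro hv
    obtain ⟨γ, hγ⟩ := exists_isOneParameterSubgroup v
    refine ⟨γ, hγ, fun s ↦ ?_⟩
    rw [h.mem_kernel, h.apply_oneParameterSubgroup hγ, LinearMap.mem_ker.1 hv, mul_zero]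

/-- The kernel is a retract of the connected group `G`, by `g ↦ γ(Ψ(g)/ψ(e))⁻¹ g` with `ψ(e) ≠ 0`.
-/
theorem isConnected_kernel [CompleteSpace E] [T2Space G] [ConnectedSpace G]
    (h : IsSmoothCharacter Ψ ψ) (hψ : ψ ≠ 0) : IsConnected (h.kernel : Set G) := by
  have : IsTopologicalGroup G := topologicalGroup_of_lieGroup 𝓘(ℝ, E) ∞
  obtain ⟨e, he⟩ : ∃ e, ψ e ≠ 0 := by
    by_contra! hc
    exact hψ (LinearMap.ext hc)
  obtain ⟨γ, hγ⟩ := exists_isOneParameterSubgroup e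
  have hcont : Continuous fun g ↦ (γ (Ψ g / ψ e))⁻¹ * g :=
    ((hγ.isMIntegralCurve.continuous.comp (h.contMDiff.continuous.div_const _)).inv).mul
      continuous_id
  convert! isConnected_range hcont
  ext g
  constructor
  · intro hg
    refine ⟨g, ?_⟩
    simp [h.mem_kernel.1 hg, hγ.map_zero]
  · rintro ⟨g, rfl⟩
    refine h.mem_kernel.2 ?_
    rw [h.map_mul, h.map_inv, h.apply_oneParameterSubgroup hγ, div_mul_cancel₀ _ he,
      neg_add_cancel]

/-- A connected normal subgroup whose Lie algebra is the kernel of `ψ` is the kernel of the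
character. -/
theorem eq_kernel [FiniteDimensional ℝ E] [T2Space G] [ConnectedSpace G]
    (h : IsSmoothCharacter Ψ ψ) (hψ : ψ ≠ 0) {H : Subgroup G} (hc : IsConnected (H : Set G))
    (hN : H.Normal)
    (hH : subgroupLieAlgebra E H = (ψ.ker : Set (GroupLieAlgebra 𝓘(ℝ, E) G))) : H = h.kernel := by
  have : CompleteSpace E := FiniteDimensional.complete ℝ E
  obtain ⟨e, he⟩ : ∃ e, ψ e ≠ 0 := by
    by_contra! hc
    exact hψ (LinearMap.ext hc)
  obtain ⟨γ, hγ⟩ := exists_isOneParameterSubgroup e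
  let R : Subgroup G :=
    { carrier := Set.range γ
      one_mem' := ⟨0, hγ.map_zero⟩
      mul_mem' := by rintro _ _ ⟨s, rfl⟩ ⟨u, rfl⟩; exact ⟨s + u, hγ.map_add s u⟩
      inv_mem' := by rintro _ ⟨s, rfl⟩; exact ⟨-s, hγ.map_neg s⟩ }
  have hmono : ∀ {A B : Subgroup G}, A ≤ B → subgroupLieAlgebra E A ⊆ subgroupLieAlgebra E B :=
    fun hAB v ⟨δ, hδ, hδA⟩ ↦ ⟨δ, hδ, fun s ↦ hAB (hδA s)⟩
  have hKN := h.normal_kernel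
  -- The intersection with the kernel still contains `exp(s X)` for every `X ∈ ker ψ`, and with `e`
  -- these `X` span. Its elements have `Ψ = 0`, so a factorisation of a kernel element has trivial
  -- factor in `R`.
  have htop : R ⊔ (H ⊓ h.kernel) = ⊤ := by
    refine eq_top_of_span_eq_top (E := E) _ (eq_top_iff.2 fun w _ ↦ ?_)
    have hw : w = (ψ w / ψ e) • e + (w - (ψ w / ψ e) • e) := by abel
    rw [hw]
    refine Submodule.add_mem _ (Submodule.smul_mem _ _ (Submodule.subset_span ?_))
      (Submodule.subset_span ?_)
    · exact hmono le_sup_left ⟨γ, hγ, fun s ↦ ⟨s, rfl⟩⟩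
    · have hker : w - (ψ w / ψ e) • e ∈ ψ.ker := by
        rw [LinearMap.mem_ker, map_sub, map_smul, smul_eq_mul, div_mul_cancel₀ _ he, sub_self]
      refine hmono le_sup_right ?_
      obtain ⟨δ, hδ, hδH⟩ := hH.ge hker
      refine ⟨δ, hδ, fun s ↦ ⟨hδH s, ?_⟩⟩
      change Ψ (δ s) = 0
      rw [h.apply_oneParameterSubgroup hδ, LinearMap.mem_ker.1 hker, mul_zero]
  have hle : h.kernel ≤ H := by
    intro k hk
    have hk' : k ∈ R ⊔ (H ⊓ h.kernel) := htop ▸ Subgroup.mem_top k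
    obtain ⟨r, ⟨s, rfl⟩, η, hη, rfl⟩ := Subgroup.mem_sup_of_normal_right.1 hk'
    have h1 := h.mem_kernel.1 hk
    rw [h.map_mul, h.apply_oneParameterSubgroup hγ, h.mem_kernel.1 hη.2, add_zero] at h1
    have h2 : s = 0 := by simpa [he] using h1
    rw [h2, hγ.map_zero, one_mul]
    exact hη.1
  refine le_antisymm (fun k hk ↦ ?_) hle
  by_contra hk0
  rw [h.mem_kernel] at hk0
  -- If `H` were larger than the kernel, `Ψ(H)` would be a nonzero connected subgroup of `ℝ`, hence
  -- all of `ℝ`.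
  let A : AddSubgroup ℝ :=
    { carrier := Ψ '' H
      zero_mem' := ⟨1, H.one_mem, h.map_one⟩
      add_mem' := by
        rintro _ _ ⟨a, ha, rfl⟩ ⟨b, hb, rfl⟩
        exact ⟨a * b, H.mul_mem ha hb, h.map_mul a b⟩
      neg_mem' := by
        rintro _ ⟨a, ha, rfl⟩
        exact ⟨a⁻¹, H.inv_mem ha, h.map_inv a⟩ }
  have hA : (A : Set ℝ).OrdConnected :=
    (hc.isPreconnected.image Ψ h.contMDiff.continuous.continuousOn).ordConnected
  have hkA : Ψ k ∈ A := ⟨k, hk, rfl⟩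
  have habs : |Ψ k| ∈ A := by
    rcases abs_choice (Ψ k) with h' | h' <;> rw [h']
    exacts [hkA, A.neg_mem hkA]
  have hnhds : (A : Set ℝ) ∈ nhds 0 :=
    Filter.mem_of_superset (Icc_mem_nhds (neg_lt_zero.2 (abs_pos.2 hk0)) (abs_pos.2 hk0))
      (hA.out (A.neg_mem habs) habs)
  have hopen : IsOpen (A : Set ℝ) := A.isOpen_of_mem_nhds hnhds
  have huniv := IsClopen.eq_univ ⟨A.isClosed_of_isOpen hopen, hopen⟩ ⟨0, A.zero_mem⟩
  -- Since `Ψ(H) = ℝ`, each `γ s` agrees with an element of `H` up to the kernel, which already lies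
  -- in `H`.
  have heH : e ∈ subgroupLieAlgebra E H := by
    refine ⟨γ, hγ, fun s ↦ ?_⟩
    obtain ⟨a, ha, has⟩ : Ψ (γ s) ∈ Ψ '' H := huniv.ge (Set.mem_univ _)
    have : γ s * a⁻¹ ∈ h.kernel := by
      rw [h.mem_kernel, h.map_mul, h.map_inv, has, add_neg_cancel]
    simpa using H.mul_mem (hle this) ha
  rw [hH] at heH
  exact he (LinearMap.mem_ker.1 heH)

omit [LieGroup 𝓘(ℝ, E) ∞ G] in
/-- Any complement of `ker ψ` gives a splitting of the group by the kernel of the character. -/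
theorem isSemidirectDecomposition (h : IsSmoothCharacter Ψ ψ) {γ : ℝ → G}
    {e : GroupLieAlgebra 𝓘(ℝ, E) G} (he : ψ e ≠ 0) (hγ : IsOneParameterSubgroup γ e) :
    IsSemidirectDecomposition E γ h.kernel (fun g ↦ Ψ g / ψ e) where
  normal := h.normal_kernel
  contMDiff_coord := h.contMDiff.div_const (ψ e)
  inv_mul_mem g := by
    rw [h.mem_kernel, h.map_mul, h.map_inv, h.apply_oneParameterSubgroup hγ, div_mul_cancel₀ _ he,
      neg_add_cancel]
  coord_mul s η hη := by
    rw [h.map_mul, h.mem_kernel.1 hη, h.apply_oneParameterSubgroup hγ, add_zero,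
      mul_div_cancel_right₀ _ he]

omit [LieGroup 𝓘(ℝ, E) ∞ G] in
/-- The real coordinate of a splitting by the kernel of the character. -/
theorem coord_eq (h : IsSmoothCharacter Ψ ψ) {γ : ℝ → G} {t : G → ℝ}
    {e : GroupLieAlgebra 𝓘(ℝ, E) G} (hγ : IsOneParameterSubgroup γ e)
    (ht : IsSemidirectDecomposition E γ h.kernel t) (g : G) : ψ e * t g = Ψ g := by
  have := h.mem_kernel.1 (ht.inv_mul_mem g)
  rw [h.map_mul, h.map_inv, h.apply_oneParameterSubgroup hγ] at this
  linarith

end IsSmoothCharacter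

end Splitting

/-! ### Derivations of alternating forms and traces -/

section ComplexTrace

variable {V : Type*} [AddCommGroup V] [Module ℂ V]

/-- The derivation of an alternating form by an endomorphism. -/
def AlternatingMap.derivation {K M N ι : Type*} [CommRing K] [AddCommGroup M] [Module K M]
    [AddCommGroup N] [Module K N] [Fintype ι] [DecidableEq ι] (σ : M [⋀^ι]→ₗ[K] N)
    (A : M →ₗ[K] M) : M [⋀^ι]→ₗ[K] N :=
  { (∑ j, σ.toMultilinearMap.compLinearMap
      (fun i ↦ if i = j then A else LinearMap.id) : MultilinearMap K (fun _ : ι ↦ M) N) with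
    map_eq_zero_of_eq' := by
      intro w a b hab hne
      have hterm : ∀ j, (σ.toMultilinearMap.compLinearMap
          (fun i ↦ if i = j then A else LinearMap.id)) w =
          σ (Function.update w j (A (w j))) := by
        intro j
        rw [MultilinearMap.compLinearMap_apply, AlternatingMap.coe_multilinearMap]
        congr 1
        ext i
        rcases eq_or_ne i j with rfl | h <;> simp [*]
      change (∑ j, σ.toMultilinearMap.compLinearMap
        (fun i ↦ if i = j then A else LinearMap.id) : MultilinearMap K (fun _ : ι ↦ M) N) w = 0
      -- With `w a = w b`, only the terms `j = a` and `j = b` can survive; they differ by a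
      -- transposition and cancel.
      rw [sum_apply, Finset.sum_congr rfl (fun j _ ↦ hterm j),
        Finset.sum_eq_add a b hne (fun c _ hc ↦ ?_) (by simp) (by simp)]
      · have h2 : Function.update w b (A (w b)) =
            Function.update w a (A (w a)) ∘ Equiv.swap a b := by
          ext i
          rcases eq_or_ne i a with rfl | hia
          · simp [hne, hne.symm, hab]
          · rcases eq_or_ne i b with rfl | hib
            · simp [hab]
            · simp [Equiv.swap_apply_of_ne_of_ne hia hib, hia, hib]
        rw [h2, σ.map_swap _ hne, add_neg_cancel]
      · exact σ.map_eq_zero_of_eq _ (by simp [hc.1.symm, hc.2.symm, hab]) hne }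

theorem AlternatingMap.derivation_apply {K M N ι : Type*} [CommRing K] [AddCommGroup M]
    [Module K M] [AddCommGroup N] [Module K N] [Fintype ι] [DecidableEq ι] (σ : M [⋀^ι]→ₗ[K] N)
    (A : M →ₗ[K] M) (w : ι → M) :
    σ.derivation A w = ∑ j, σ (Function.update w j (A (w j))) := by
  change (∑ j, σ.toMultilinearMap.compLinearMap
    (fun i ↦ if i = j then A else LinearMap.id) : MultilinearMap K (fun _ : ι ↦ M) N) w = _
  rw [sum_apply]
  refine Finset.sum_congr rfl fun j _ ↦ ?_
  rw [MultilinearMap.compLinearMap_apply, AlternatingMap.coe_multilinearMap]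
  congr 1
  ext i
  rcases eq_or_ne i j with rfl | h <;> simp [*]

/-- On top degree forms the derivation by an endomorphism is multiplication by its trace. -/
theorem AlternatingMap.derivation_eq_trace_smul {K M ι : Type*} [CommRing K] [AddCommGroup M]
    [Module K M] [Fintype ι] [DecidableEq ι] (b : Module.Basis ι K M) (σ : M [⋀^ι]→ₗ[K] K)
    (A : M →ₗ[K] M) : σ.derivation A = LinearMap.trace K M A • σ := by
  have hb : σ.derivation A b = LinearMap.trace K M A * σ b := by
    rw [derivation_apply, LinearMap.trace_eq_matrix_trace K b, Matrix.trace, Finset.sum_mul]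
    refine Finset.sum_congr rfl fun j _ ↦ ?_
    rw [Matrix.diag_apply, LinearMap.toMatrix_apply]
    conv_lhs => rw [← b.sum_repr (A (b j))]
    rw [σ.map_update_sum, Finset.sum_eq_single j]
    · rw [σ.map_update_smul, Function.update_eq_self, smul_eq_mul]
    · intro k _ hk
      rw [σ.map_update_smul, σ.map_update_self _ hk.symm, smul_zero]
    · simp
  rw [(σ.derivation A).eq_smul_basis_det b, hb, mul_smul, ← σ.eq_smul_basis_det b]

/-- In the real basis `b j, i b j` a complex diagonal entry contributes its real part twice. -/
theorem trace_restrictScalars_eq_two_mul_re [Module ℝ V] [IsScalarTower ℝ ℂ V] {n : ℕ}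
    (b : Module.Basis (Fin n) ℂ V) (A : V →ₗ[ℂ] V) :
    LinearMap.trace ℝ V (A.restrictScalars ℝ) = 2 * (LinearMap.trace ℂ V A).re := by
  rw [LinearMap.trace_eq_matrix_trace ℝ (Complex.basisOneI.smulTower b),
    LinearMap.trace_eq_matrix_trace ℂ b, Matrix.trace, Matrix.trace, Fintype.sum_prod_type,
    Fin.sum_univ_two, Complex.re_sum, ← Finset.sum_add_distrib, Finset.mul_sum]
  refine Finset.sum_congr rfl fun j _ ↦ ?_
  simp [Matrix.diag_apply, LinearMap.toMatrix_apply, Module.Basis.smulTower_repr,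
    Module.Basis.smulTower_apply, two_mul]

end ComplexTrace

/-! ### Linear algebra of a complex structure -/

section ComplexStructure

variable {V : Type*} [AddCommGroup V] [Module ℝ V]

/-- A complex structure on a real vector space makes it a complex vector space. -/
abbrev complexModule (J : V →ₗ[ℝ] V) (hJ : ∀ v, J (J v) = -v) : Module ℂ V :=
  Module.compHom V (Complex.lift ⟨J, LinearMap.ext hJ⟩ : ℂ →ₐ[ℝ] Module.End ℝ V).toRingHom

theorem complexModule_smul_def (J : V →ₗ[ℝ] V) (hJ : ∀ v, J (J v) = -v) (z : ℂ) (v : V) :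
    (letI := complexModule J hJ; z • v) = z.re • v + z.im • J v := by
  change (Complex.lift ⟨J, LinearMap.ext hJ⟩ : ℂ →ₐ[ℝ] Module.End ℝ V) z v = _
  simp [Complex.liftAux_apply]

theorem isScalarTower_complexModule (J : V →ₗ[ℝ] V) (hJ : ∀ v, J (J v) = -v) :
    let := complexModule J hJ; IsScalarTower ℝ ℂ V := by
  let := complexModule J hJ
  refine ⟨fun r z v ↦ ?_⟩
  rw [complexModule_smul_def J hJ, complexModule_smul_def J hJ]
  simp [smul_smul]

theorem exists_complexBasis [FiniteDimensional ℝ V] (J : V →ₗ[ℝ] V) (hJ : ∀ v, J (J v) = -v)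
    {n : ℕ} (hn : Module.finrank ℝ V = 2 * n) :
    let := complexModule J hJ; Nonempty (Module.Basis (Fin n) ℂ V) := by
  let := complexModule J hJ
  have := isScalarTower_complexModule J hJ
  have : FiniteDimensional ℂ V := FiniteDimensional.right ℝ ℂ V
  have h := Module.finrank_mul_finrank ℝ ℂ V
  rw [hn, Complex.finrank_real_complex] at h
  exact ⟨Module.finBasisOfFinrankEq ℂ V (by omega)⟩

/-- For a form of type `(n, 0)` and a complex linear endomorphism `A`, the derivation by `A` is
multiplication by the complex trace of `A`, expressed with real traces. -/
theorem AlternatingMap.derivation_of_typeZero [FiniteDimensional ℝ V] (J : V →ₗ[ℝ] V)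
    (hJ : ∀ v, J (J v) = -v) {n : ℕ} (hn : Module.finrank ℝ V = 2 * n) (σ : V [⋀^Fin n]→ₗ[ℝ] ℂ)
    (hσ : ∀ (w : Fin n → V) (j : Fin n),
      σ (Function.update w j (J (w j))) = Complex.I * σ w)
    (A : V →ₗ[ℝ] V) (hA : ∀ v, A (J v) = J (A v)) (w : Fin n → V) :
    ∑ j, σ (Function.update w j (A (w j))) =
      ((LinearMap.trace ℝ V A : ℂ) - Complex.I * (LinearMap.trace ℝ V (J ∘ₗ A) : ℂ)) / 2 *
        σ w := by
  let := complexModule J hJ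
  have := isScalarTower_complexModule J hJ
  obtain ⟨b⟩ := exists_complexBasis J hJ hn
  have hJI : ∀ v : V, J v = Complex.I • v := fun v ↦ by
    rw [complexModule_smul_def J hJ]; simp
  -- Type `(n, 0)` means complex multilinear for the structure defined by `J`, so `σ` is a top
  -- degree complex form.
  let σ' : V [⋀^Fin n]→ₗ[ℂ] ℂ :=
    { σ with
      map_update_smul' := by
        intro inst w j z x
        have hi : inst = instDecidableEqFin n := Subsingleton.elim _ _
        subst hi
        change σ (Function.update w j (z • x)) = z • σ (Function.update w j x)
        have h1 := hσ (Function.update w j x) j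
        rw [Function.update_idem, Function.update_self] at h1
        rw [complexModule_smul_def J hJ, σ.map_update_add, σ.map_update_smul, σ.map_update_smul,
          h1]
        simp only [Complex.real_smul, smul_eq_mul]
        rw [← mul_assoc, ← add_mul, Complex.re_add_im] }
  let A' : V →ₗ[ℂ] V :=
    { A with
      map_smul' := by
        intro z x
        change A (z • x) = z • A x
        rw [complexModule_smul_def J hJ, complexModule_smul_def J hJ, map_add, map_smul, map_smul,
          hA] }
  have h1 : σ'.derivation A' w = ∑ j, σ (Function.update w j (A (w j))) :=
    σ'.derivation_apply A' w
  rw [← h1, σ'.derivation_eq_trace_smul b, AlternatingMap.smul_apply, smul_eq_mul]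
  have h2 : LinearMap.trace ℝ V A = 2 * (LinearMap.trace ℂ V A').re :=
    trace_restrictScalars_eq_two_mul_re b A'
  -- The real trace sees only real parts; the imaginary part of the complex trace is recovered from
  -- `i A`.
  have h3 : LinearMap.trace ℝ V (J ∘ₗ A) = 2 * (LinearMap.trace ℂ V (Complex.I • A')).re := by
    rw [← trace_restrictScalars_eq_two_mul_re b]
    congr 1
    ext v
    exact hJI (A v)
  rw [map_smul, smul_eq_mul, Complex.I_mul_re] at h3
  have h4 : LinearMap.trace ℂ V A' =
      ((LinearMap.trace ℝ V A : ℂ) - Complex.I * (LinearMap.trace ℝ V (J ∘ₗ A) : ℂ)) / 2 := by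
    rw [h2, h3]
    apply Complex.ext <;> simp
  rw [h4]
  rfl

/-- An alternating form of degree larger than the complex dimension vanishes if it vanishes on
all tuples starting with `v, J v`. -/
theorem AlternatingMap.eq_zero_of_forall_cons_cons [FiniteDimensional ℝ V] (J : V →ₗ[ℝ] V)
    (hJ : ∀ v, J (J v) = -v) {m : ℕ} (hm : Module.finrank ℝ V = 2 * (m + 1))
    (η : V [⋀^Fin (m + 2)]→ₗ[ℝ] ℂ)
    (hη : ∀ (v : V) (x : Fin m → V), η (Matrix.vecCons v (Matrix.vecCons (J v) x)) = 0) :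
    η = 0 := by
  let := complexModule J hJ
  have := isScalarTower_complexModule J hJ
  obtain ⟨b⟩ := exists_complexBasis J hJ hm
  have hpair : ∀ (w : Fin (m + 2) → V) (i j : Fin (m + 2)), i ≠ j → w j = J (w i) → η w = 0 := by
    intro w i j hij hw
    obtain ⟨p, hp0, hp1⟩ : ∃ p : Equiv.Perm (Fin (m + 2)), p 0 = i ∧ p 1 = j := by
      refine ⟨Equiv.swap (Equiv.swap 0 i 1) j * Equiv.swap 0 i, ?_, ?_⟩
      · rw [Equiv.Perm.mul_apply, Equiv.swap_apply_left, Equiv.swap_apply_of_ne_of_ne _ hij]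
        intro h
        have h' : Equiv.swap 0 i 0 = Equiv.swap 0 i 1 := by rw [Equiv.swap_apply_left]; exact h
        exact absurd ((Equiv.swap 0 i).injective h') (by simp)
      · rw [Equiv.Perm.mul_apply, Equiv.swap_apply_left]
    have h := η.map_perm w p
    have hc : w ∘ p = Matrix.vecCons (w i) (Matrix.vecCons (J (w i))
        (fun k ↦ w (p k.succ.succ))) := by
      ext k
      refine Fin.cases ?_ (fun k ↦ Fin.cases ?_ (fun k ↦ ?_) k) k
      · simp [hp0]
      · simp [← hw, ← hp1]
      · simp
    rw [hc, hη] at h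
    rcases Int.units_eq_one_or (Equiv.Perm.sign p) with hs | hs <;> simpa [hs] using h.symm
  refine Module.Basis.ext_alternating (Complex.basisOneI.smulTower b) fun v hv ↦ ?_
  -- Pigeonhole: `m + 2` distinct vectors of the real basis share `m + 1` complex directions, so two
  -- of them are `b k` and `J (b k)`.
  obtain ⟨i, j, hij, h2⟩ := Fintype.exists_ne_map_eq_of_card_lt (fun i ↦ (v i).2) (by simp)
  have h1 : (v i).1 ≠ (v j).1 := fun h ↦ hij (hv (Prod.ext h h2))
  have hval : ∀ i, (Complex.basisOneI.smulTower b) (v i) = Complex.basisOneI (v i).1 • b (v i).2 :=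
    fun i ↦ Module.Basis.smulTower_apply _ _ _
  have hJI : ∀ v : V, J v = Complex.I • v := fun v ↦ by
    rw [complexModule_smul_def J hJ]; simp
  have h2' : (v i).2 = (v j).2 := h2
  rw [AlternatingMap.zero_apply]
  rcases (by omega : ((v i).1 = 0 ∧ (v j).1 = 1) ∨ ((v i).1 = 1 ∧ (v j).1 = 0)) with h | h
  · refine hpair _ i j hij ?_
    rw [hval, hval, hJI, h.1, h.2, h2']
    simp
  · refine hpair _ j i hij.symm ?_
    rw [hval, hval, hJI, h.1, h.2, h2']
    simp

end ComplexStructure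

/-! ### The Chevalley–Eilenberg differential on forms of type `(n, 0)` -/

section ChevalleyEilenberg

theorem Fin.removeNth_succ_vecCons {α : Type*} {n : ℕ} (k : Fin (n + 1)) (a : α)
    (x : Fin (n + 1) → α) :
    k.succ.removeNth (Matrix.vecCons a x) = Matrix.vecCons a (k.removeNth x) := by
  ext i
  refine Fin.cases ?_ (fun i ↦ ?_) i <;> simp [Fin.removeNth]

theorem Fin.removeNth_zero_vecCons {α : Type*} {n : ℕ} (a : α) (x : Fin n → α) :
    (0 : Fin (n + 1)).removeNth (Matrix.vecCons a x) = x := by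
  ext i
  simp [Fin.removeNth]

/-- Moving the first argument of an alternating map into the place of another one. -/
theorem AlternatingMap.neg_one_pow_smul_map_vecCons_vecCons_removeNth {K M N : Type*} [CommRing K]
    [AddCommGroup M] [Module K M] [AddCommGroup N] [Module K N] {m : ℕ}
    (σ : M [⋀^Fin (m + 2)]→ₗ[K] N) (y z : M) (x : Fin (m + 1) → M) (k : Fin (m + 1)) :
    (-1 : ℤ) ^ (k : ℕ) • σ (Matrix.vecCons y (Matrix.vecCons z (k.removeNth x))) =
      -σ (Matrix.vecCons z (Function.update x k y)) := by
  have h := σ.neg_one_pow_smul_map_insertNth k.succ y (Matrix.vecCons z (k.removeNth x))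
  have h2 : k.succ.insertNth y (Matrix.vecCons z (k.removeNth x)) =
      Matrix.vecCons z (Function.update x k y) :=
    (Fin.insertNth_succ_cons k y z _).trans (congrArg _ (Fin.insertNth_removeNth k y x))
  rw [h2, Fin.val_succ, pow_succ, mul_neg_one] at h
  rw [← h]
  rcases neg_one_pow_eq_or ℤ (k : ℕ) with hk | hk <;> simp [hk] at h ⊢

/-- Pulling `J` out as a factor `i` leaves a repeated argument. -/
theorem AlternatingMap.eq_zero_of_apply_eq {V ι : Type*} [AddCommGroup V] [Module ℝ V]
    [DecidableEq ι] (J : V → V) (σ : V [⋀^ι]→ₗ[ℝ] ℂ)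
    (hσ : ∀ w j, σ (Function.update w j (J (w j))) = Complex.I * σ w) {w : ι → V} {a b : ι}
    (hab : a ≠ b) (h : w a = J (w b)) : σ w = 0 := by
  have e := hσ (Function.update w a (w b)) a
  rw [Function.update_idem, Function.update_self, ← h, Function.update_eq_self] at e
  rw [e, σ.map_eq_zero_of_eq _ (i := a) (j := b) (by simp [hab.symm]) hab, mul_zero]

section LieAlgebra

variable {L : Type*} [LieRing L] [LieAlgebra ℝ L] {m : ℕ} (J : L →ₗ[ℝ] L)
  (σ : L [⋀^Fin (m + 1)]→ₗ[ℝ] ℂ)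

/-- Brackets of two entries of `x` leave both `v` and `Jv` as arguments and contribute nothing. The
bracket of `v` and `Jv` gives the `0`th term of the derivation by `ad(Jv) - J ad v`. Those of `v`
and `Jv` with an entry of `x` give the others: where `v` is consumed, the remaining `Jv` becomes `v`
by moving `J` onto the bracket. -/
theorem AlternatingMap.sum_bracket_of_typeZero
    (hσ : ∀ w j, σ (Function.update w j (J (w j))) = Complex.I * σ w) (v : L) (x : Fin m → L)
    (w : Fin (m + 2) → L) (hw : w = Matrix.vecCons v (Matrix.vecCons (J v) x)) :
    -∑ i : Fin (m + 1), ∑ j ≥ i, (-1 : ℤ) ^ (i + j : ℕ) •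
        σ (Matrix.vecCons ⁅w i.castSucc, w j.succ⁆ (j.removeNth (i.castSucc.removeNth w))) =
      ∑ j, σ (Function.update (Matrix.vecCons v x) j
        ((LieAlgebra.ad ℝ L (J v) - J ∘ₗ LieAlgebra.ad ℝ L v) (Matrix.vecCons v x j))) := by
  subst hw
  have hI : ∀ x : Fin m → L, σ (Matrix.vecCons (J v) x) = Complex.I * σ (Matrix.vecCons v x) := by
    intro x
    have := hσ (Matrix.vecCons v x) 0
    rwa [Matrix.cons_val_zero, Matrix.vecCons, Fin.update_cons_zero] at this
  rw [Fin.sum_univ_succ, Fin.sum_univ_succ, ← bot_eq_zero, Finset.Ici_bot, Fin.sum_univ_succ,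
    bot_eq_zero]
  simp only [Fin.sum_Ici_succ, Fin.castSucc_zero, Fin.removeNth_zero_vecCons, Matrix.cons_val_zero,
    Matrix.cons_val_succ, Fin.val_zero, Fin.val_succ, zero_add, add_zero, pow_zero, one_smul]
  rw [neg_add, neg_add, add_assoc]
  congr 1
  · have e := σ.map_update_neg (Matrix.vecCons v x) 0 ⁅v, J v⁆
    simp only [Matrix.vecCons, Fin.update_cons_zero] at e ⊢
    rw [← e]
    simp
  · rcases m with _ | m
    · simp
    have hA : ∀ k y, σ (Function.update (Matrix.vecCons v x) k.succ (J y)) =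
        σ (Matrix.vecCons (J v) (Function.update x k y)) := by
      intro k y
      have e := hσ (Function.update (Matrix.vecCons v x) k.succ y) k.succ
      rw [Function.update_idem, Function.update_self] at e
      rw [e, hI, Matrix.vecCons, Matrix.vecCons, Fin.cons_update]
    have h1 : ∀ k : Fin (m + 1), (-1 : ℤ) ^ ((k : ℕ) + 1) •
        σ (Matrix.vecCons ⁅v, x k⁆ (k.succ.removeNth (Matrix.vecCons (J v) x))) =
          σ (Function.update (Matrix.vecCons v x) k.succ (J ⁅v, x k⁆)) := by
      intro k
      rw [hA, Fin.removeNth_succ_vecCons, pow_succ, mul_neg_one, neg_smul,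
        σ.neg_one_pow_smul_map_vecCons_vecCons_removeNth, neg_neg]
    rw [Fin.sum_univ_succ (n := m) (f := fun i ↦ ∑ j ≥ i, _),
      Finset.sum_eq_zero (s := Finset.univ (α := Fin m)), add_zero]
    · have hIci : Finset.Ici (0 : Fin (m + 1)) = Finset.univ := Finset.Ici_bot
      rw [hIci, ← neg_add, ← Finset.sum_add_distrib, ← Finset.sum_neg_distrib]
      refine Finset.sum_congr rfl fun k _ ↦ ?_
      have e1 : ∀ y z, σ (Function.update (Matrix.vecCons v x) k.succ (y - z)) =
        σ (Function.update (Matrix.vecCons v x) k.succ y) -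
          σ (Function.update (Matrix.vecCons v x) k.succ z) := fun y z ↦ σ.map_update_sub _ _ _ _
      rw [LinearMap.sub_apply, e1, LinearMap.comp_apply, LieAlgebra.ad_apply, LieAlgebra.ad_apply]
      have h2 := σ.neg_one_pow_smul_map_vecCons_vecCons_removeNth ⁅J v, x k⁆ v x k
      rw [h1, Fin.castSucc_succ, Fin.castSucc_zero, Matrix.cons_val_succ, Matrix.cons_val_zero,
        Fin.removeNth_succ_vecCons, Fin.removeNth_succ_vecCons, Fin.removeNth_zero_vecCons,
        Fin.val_zero, zero_add, add_left_comm, pow_add, pow_two, neg_one_mul, neg_neg, mul_one, h2,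
        Matrix.vecCons, Matrix.vecCons, Fin.cons_update]
      ring
    · intro i _
      refine Finset.sum_eq_zero fun j hj ↦ ?_
      obtain ⟨j, rfl⟩ : ∃ j', j = Fin.succ j' :=
        (Fin.exists_succ_eq.2 fun h ↦ by simp [h] at hj).imp fun _ ↦ Eq.symm
      rcases m with _ | m
      · exact i.elim0
      rw [AlternatingMap.eq_zero_of_apply_eq J σ hσ (a := Fin.succ (Fin.succ 0))
        (b := Fin.succ 0)
        (by rw [Ne, Fin.succ_inj]; exact Fin.succ_ne_zero 0), smul_zero]
      rw [Fin.castSucc_succ, Fin.castSucc_succ, Fin.removeNth_succ_vecCons,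
        Fin.removeNth_succ_vecCons, Fin.removeNth_succ_vecCons, Fin.removeNth_succ_vecCons]
      rfl

/-- Only removing `v` or `Jv` leaves a nonzero value of `σ`; removing `v` yields the factor `i`. -/
theorem AlternatingMap.sum_smul_removeNth_of_typeZero
    (hσ : ∀ w j, σ (Function.update w j (J (w j))) = Complex.I * σ w) (v : L) (x : Fin m → L)
    (c : L → ℂ) (w : Fin (m + 2) → L) (hw : w = Matrix.vecCons v (Matrix.vecCons (J v) x)) :
    ∑ i : Fin (m + 2), (-1 : ℤ) ^ (i : ℕ) • (c (w i) * σ (i.removeNth w)) =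
      (c v * Complex.I - c (J v)) * σ (Matrix.vecCons v x) := by
  subst hw
  have hI : σ (Matrix.vecCons (J v) x) = Complex.I * σ (Matrix.vecCons v x) := by
    have := hσ (Matrix.vecCons v x) 0
    rwa [Matrix.cons_val_zero, Matrix.vecCons, Fin.update_cons_zero] at this
  rw [Fin.sum_univ_succ, Fin.sum_univ_succ, Finset.sum_eq_zero (s := Finset.univ (α := Fin m))]
  · have h1 : Fin.removeNth (Fin.succ 0) (Matrix.vecCons v (Matrix.vecCons (J v) x)) =
        Matrix.vecCons v x := by
      rcases m with _ | m
      · ext i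
        fin_cases i
        rfl
      · rw [Fin.removeNth_succ_vecCons, Fin.removeNth_zero_vecCons]
    rw [h1, Fin.removeNth_zero_vecCons, hI]
    simp
    ring
  · intro i _
    rcases m with _ | m
    · exact i.elim0
    rw [AlternatingMap.eq_zero_of_apply_eq J σ hσ (a := Fin.succ 0) (b := 0) (by simp), mul_zero,
      smul_zero]
    rw [Fin.removeNth_succ_vecCons, Fin.removeNth_succ_vecCons]
    rfl

/-- The closedness of `exp (-(i/2) Ψ) σ`, evaluated on vectors that contain a pair `v, J v`. -/
theorem AlternatingMap.sum_add_sum_bracket_of_typeZero [FiniteDimensional ℝ L]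
    (hJ : ∀ v, J (J v) = -v) (hm : Module.finrank ℝ L = 2 * (m + 1))
    (hN : ∀ u v, ⁅u, v⁆ + J (⁅J u, v⁆ + ⁅u, J v⁆) - ⁅J u, J v⁆ = 0)
    (hσ : ∀ w j, σ (Function.update w j (J (w j))) = Complex.I * σ w) (ψ : L → ℝ)
    (hψ : ∀ v, ψ v = LinearMap.trace ℝ L (J ∘ₗ LieAlgebra.ad ℝ L v) -
      LinearMap.trace ℝ L (LieAlgebra.ad ℝ L (J v))) (v : L) (x : Fin m → L)
    (w : Fin (m + 2) → L) (hw : w = Matrix.vecCons v (Matrix.vecCons (J v) x)) :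
    ∑ i : Fin (m + 2), (-1 : ℤ) ^ (i : ℕ) • (-(Complex.I / 2) * ψ (w i) * σ (i.removeNth w)) -
      ∑ i : Fin (m + 1), ∑ j ≥ i, (-1 : ℤ) ^ (i + j : ℕ) •
        σ (Matrix.vecCons ⁅w i.castSucc, w j.succ⁆ (j.removeNth (i.castSucc.removeNth w))) = 0 := by
  -- The failure of `ad(Jv) - J ad v` to commute with `J` is, up to sign, the Nijenhuis tensor at
  -- `(v, y)`.
  have hA : ∀ y, (LieAlgebra.ad ℝ L (J v) - J ∘ₗ LieAlgebra.ad ℝ L v) (J y) =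
      J ((LieAlgebra.ad ℝ L (J v) - J ∘ₗ LieAlgebra.ad ℝ L v) y) := by
    intro y
    have h := hN v y
    rw [map_add] at h
    simp only [LinearMap.sub_apply, LinearMap.comp_apply, LieAlgebra.ad_apply, map_sub, hJ]
    rw [← sub_eq_zero, ← neg_eq_zero, ← h]
    abel
  have hJJ : J ∘ₗ (J ∘ₗ LieAlgebra.ad ℝ L v) = -LieAlgebra.ad ℝ L v := by
    ext y
    simp [hJ]
  have e1 : LinearMap.trace ℝ L (LieAlgebra.ad ℝ L (J v) - J ∘ₗ LieAlgebra.ad ℝ L v) = -ψ v := by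
    rw [map_sub, hψ]
    ring
  have e2 : LinearMap.trace ℝ L (J ∘ₗ (LieAlgebra.ad ℝ L (J v) - J ∘ₗ LieAlgebra.ad ℝ L v)) =
      ψ (J v) := by
    rw [LinearMap.comp_sub, hJJ, map_sub, hψ, hJ, map_neg, map_neg, map_neg]
  have h2 := AlternatingMap.sum_bracket_of_typeZero J σ hσ v x w hw
  rw [AlternatingMap.derivation_of_typeZero J hJ hm σ hσ _ hA, e1, e2] at h2
  rw [sub_eq_add_neg, h2, AlternatingMap.sum_smul_removeNth_of_typeZero J σ hσ v x
    (fun u ↦ -(Complex.I / 2) * ψ u) w hw]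
  push_cast
  linear_combination (-(1 / 2 : ℂ) * ψ v * σ (Matrix.vecCons v x)) * Complex.I_sq

end LieAlgebra

end ChevalleyEilenberg

/-! ### Smooth dependence of pulled back alternating forms -/

section SmoothPullback

variable {E F H : Type*} [NormedAddCommGroup E] [NormedSpace ℝ E] [NormedAddCommGroup F]
  [NormedSpace ℝ F] [NormedAddCommGroup H] [NormedSpace ℝ H]

/-- The projection of multilinear maps onto alternating maps, as a continuous linear map. -/
def ContinuousMultilinearMap.antisymmetrizationCLM (k : ℕ) :
    ContinuousMultilinearMap ℝ (fun _ : Fin k ↦ E) F →L[ℝ] E [⋀^Fin k]→L[ℝ] F :=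
  LinearMap.mkContinuous
    -- The factor `1/k!` makes the map the identity on alternating forms.
    { toFun := fun f ↦ (k.factorial : ℝ)⁻¹ • ContinuousMultilinearMap.alternatization f
      map_add' := fun f g ↦ by rw [map_add, smul_add]
      map_smul' := fun c f ↦ by
        ext v
        change (k.factorial : ℝ)⁻¹ • (ContinuousMultilinearMap.alternatization (c • f)) v =
          c • (k.factorial : ℝ)⁻¹ • (ContinuousMultilinearMap.alternatization f) v
        rw [ContinuousMultilinearMap.alternatization_apply_apply,
          ContinuousMultilinearMap.alternatization_apply_apply, smul_comm c,
          Finset.smul_sum (r := c)]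
        exact congrArg _ (Finset.sum_congr rfl fun σ _ ↦ smul_comm _ _ _) }
    1 fun f ↦ by
      rw [one_mul]
      refine ContinuousAlternatingMap.opNorm_le_bound _ (norm_nonneg _) fun v ↦ ?_
      have h : ∀ σ : Equiv.Perm (Fin k), ‖Equiv.Perm.sign σ • f (v ∘ σ)‖ ≤ ‖f‖ * ∏ i, ‖v i‖ := by
        intro σ
        have h1 : ‖Equiv.Perm.sign σ • f (v ∘ σ)‖ = ‖f (v ∘ σ)‖ := by
          rcases Int.units_eq_one_or (Equiv.Perm.sign σ) with h | h <;> simp [h]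
        rw [h1, ← Equiv.prod_comp σ (fun i ↦ ‖v i‖)]
        exact f.le_opNorm _
      have h2 := norm_sum_le_of_le Finset.univ fun σ _ ↦ h σ
      rw [Finset.sum_const, Finset.card_univ, Fintype.card_perm, Fintype.card_fin,
        nsmul_eq_mul] at h2
      change ‖(k.factorial : ℝ)⁻¹ • (ContinuousMultilinearMap.alternatization f) v‖ ≤ _
      rw [ContinuousMultilinearMap.alternatization_apply_apply, norm_smul, norm_inv,
        Real.norm_natCast, inv_mul_le_iff₀ (by positivity)]
      exact h2

theorem ContinuousMultilinearMap.antisymmetrizationCLM_apply {k : ℕ} (f : E [⋀^Fin k]→L[ℝ] F) :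
    antisymmetrizationCLM k f.toContinuousMultilinearMap = f := by
  ext v
  change (k.factorial : ℝ)⁻¹ • (ContinuousMultilinearMap.alternatization
    f.toContinuousMultilinearMap) v = _
  rw [ContinuousMultilinearMap.alternatization_apply_apply]
  have h : ∀ σ : Equiv.Perm (Fin k), Equiv.Perm.sign σ • f (v ∘ σ) = f v := by
    intro σ
    have := f.toAlternatingMap.map_perm v σ
    rcases Int.units_eq_one_or (Equiv.Perm.sign σ) with h | h <;> simp [h] at this ⊢ <;>
      simp [this]
  change (k.factorial : ℝ)⁻¹ • ∑ σ : Equiv.Perm (Fin k), Equiv.Perm.sign σ • f (v ∘ σ) = f v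
  rw [Finset.sum_congr rfl fun σ _ ↦ h σ, Finset.sum_const, Finset.card_univ, Fintype.card_perm,
    Fintype.card_fin, ← Nat.cast_smul_eq_nsmul ℝ, inv_smul_smul₀ (by positivity)]

/-- Among multilinear maps the pullback is a continuous multilinear function of `k` copies of `B`,
hence smooth; the continuous projection brings it back to alternating maps. -/
theorem ContDiffAt.continuousAlternatingMap_compContinuousLinearMap {k : ℕ}
    (A : F [⋀^Fin k]→L[ℝ] H) {B : E → E →L[ℝ] F} {y : E} (hB : ContDiffAt ℝ ∞ B y) :
    ContDiffAt ℝ ∞ (fun z ↦ A.compContinuousLinearMap (B z)) y := by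
  have h1 : ContDiff ℝ ∞ (fun b : Fin k → E →L[ℝ] F ↦
      ContinuousMultilinearMap.compContinuousLinearMapContinuousMultilinear ℝ
        (fun _ : Fin k ↦ E) (fun _ ↦ F) H b A.toContinuousMultilinearMap) :=
    (ContinuousMultilinearMap.contDiff _).clm_apply contDiff_const
  have h2 := ((ContinuousMultilinearMap.antisymmetrizationCLM (E := E) (F := H) k).contDiff.comp
    h1).contDiffAt.comp y (contDiffAt_pi.2 fun _ : Fin k ↦ hB)
  refine h2.congr_of_eventuallyEq (Filter.Eventually.of_forall fun z ↦ ?_)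
  exact (ContinuousMultilinearMap.antisymmetrizationCLM_apply _).symm

end SmoothPullback

/-! ### Multiples of left invariant forms in charts -/

section InvariantForms

theorem contMDiff_cexp_mul {E M : Type*} [NormedAddCommGroup E] [NormedSpace ℝ E]
    [TopologicalSpace M] [ChartedSpace E M] {f : M → ℝ} (hf : ContMDiff 𝓘(ℝ, E) 𝓘(ℝ, ℝ) ∞ f)
    (a : ℂ) : ContMDiff 𝓘(ℝ, E) 𝓘(ℝ, ℂ) ∞ (fun p ↦ Complex.exp (a * f p)) := by
  have : ContDiff ℝ ∞ fun s : ℝ ↦ Complex.exp (a * s) :=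
    (contDiff_const.mul Complex.ofRealCLM.contDiff).cexp
  exact this.contMDiff.comp hf

variable {E : Type*} [NormedAddCommGroup E] [NormedSpace ℝ E]
  {G : Type*} [TopologicalSpace G] [ChartedSpace E G] [Group G]

theorem ComplexForm.IsLeftInvariant.apply_mulInvariantVectorField {k : ℕ} {σ : ComplexForm E G k}
    (hσ : σ.IsLeftInvariant) (g : G) (v : Fin k → GroupLieAlgebra 𝓘(ℝ, E) G) :
    σ g (fun i ↦ mulInvariantVectorField (v i) g) = σ 1 v := by
  -- Left invariance speaks of the fibre at `g * 1`, which equals `g` only propositionally.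
  have h : ∀ g' : G, g' = g → ∀ w : Fin k → E, σ g' w = σ g w := by rintro _ rfl w; rfl
  exact (h _ (mul_one g) _).symm.trans (DFunLike.congr_fun (hσ g 1) v)

variable [LieGroup 𝓘(ℝ, E) ∞ G]

theorem ComplexForm.IsLeftInvariant.inChart_smul_invariantFrame {k : ℕ} {σ τ : ComplexForm E G k}
    (hσ : σ.IsLeftInvariant) {c : G → ℂ} (hτ : ∀ g, τ g = c g • σ g) {x : G} {y : E}
    (hy : y ∈ (extChartAt 𝓘(ℝ, E) x).target) (v : Fin k → E) :
    τ.inChart x y (fun i ↦ invariantFrame x y (v i)) =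
      c ((extChartAt 𝓘(ℝ, E) x).symm y) * σ 1 v := by
  have h := hσ.apply_mulInvariantVectorField ((extChartAt 𝓘(ℝ, E) x).symm y) v
  rw [ComplexForm.inChart, hτ, ← h]
  exact congrArg (fun w : Fin k → E ↦ c ((extChartAt 𝓘(ℝ, E) x).symm y) *
    σ ((extChartAt 𝓘(ℝ, E) x).symm y) w)
      (funext fun i ↦ mfderiv_extChartAt_symm_invariantFrame hy (v i))

/-- The local expression is `c` times the pullback of the fixed form `σ 1` by the inverse frame, and
both depend smoothly on the point. -/
theorem ComplexForm.IsLeftInvariant.contDiffAt_inChart_smul [FiniteDimensional ℝ E] {k : ℕ}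
    {σ τ : ComplexForm E G k} (hσ : σ.IsLeftInvariant) {c : G → ℂ} (hτ : ∀ g, τ g = c g • σ g)
    (hc : ContMDiff 𝓘(ℝ, E) 𝓘(ℝ, ℂ) ∞ c) {x : G} {y : E}
    (hy : y ∈ (extChartAt 𝓘(ℝ, E) x).target) : ContDiffAt ℝ ∞ (τ.inChart x) y := by
  have h1 : ContDiffAt ℝ ∞ (fun z ↦ c ((extChartAt 𝓘(ℝ, E) x).symm z)) y :=
    (hc.contMDiffAt.comp y (contMDiffAt_extChartAt_symm_infty hy)).contDiffAt
  have h2 := h1.smul (ContDiffAt.continuousAlternatingMap_compContinuousLinearMap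
    (F := E) (σ 1) (contDiffAt_inverse_invariantFrame hy))
  refine h2.congr_of_eventuallyEq ?_
  filter_upwards [(isOpen_extChartAt_target x).mem_nhds hy] with z hz
  ext w
  obtain ⟨v, rfl⟩ : ∃ v : Fin k → E, w = fun i ↦ invariantFrame x z (v i) := by
    choose v hv using fun i ↦ (isInvertible_invariantFrame hz).bijective.2 (w i)
    exact ⟨v, funext fun i ↦ (hv i).symm⟩
  rw [hσ.inChart_smul_invariantFrame hτ hz]
  refine congrArg (fun u : Fin k → E ↦ c ((extChartAt 𝓘(ℝ, E) x).symm z) * σ 1 u) ?_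
  exact funext fun i ↦ ((isInvertible_invariantFrame hz).inverse_apply_self (v i)).symm

theorem fderiv_cexp_mul_invariantFrame {c : G → ℂ} {x : G} {y : E}
    (hy : y ∈ (extChartAt 𝓘(ℝ, E) x).target) {Ψ : G → ℝ} {a : ℂ}
    (hΨ : MDifferentiableAt 𝓘(ℝ, E) 𝓘(ℝ, ℝ) Ψ ((extChartAt 𝓘(ℝ, E) x).symm y))
    (hc : ∀ g, c g = Complex.exp (a * Ψ g)) (b : ℂ) (v : GroupLieAlgebra 𝓘(ℝ, E) G) (d : ℝ)
    (hd : mfderiv 𝓘(ℝ, E) 𝓘(ℝ, ℝ) Ψ ((extChartAt 𝓘(ℝ, E) x).symm y)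
      (mulInvariantVectorField v ((extChartAt 𝓘(ℝ, E) x).symm y)) = d) :
    fderiv ℝ (fun z : E ↦ c ((extChartAt 𝓘(ℝ, E) x).symm z) * b) y (invariantFrame x y v) =
      c ((extChartAt 𝓘(ℝ, E) x).symm y) * (a * d * b) := by
  have h1 : HasFDerivAt (Ψ ∘ (extChartAt 𝓘(ℝ, E) x).symm)
      (fderiv ℝ (Ψ ∘ (extChartAt 𝓘(ℝ, E) x).symm) y) y :=
    (hΨ.comp y ((contMDiffAt_extChartAt_symm_infty hy).mdifferentiableAt
        (by simp))).differentiableAt.hasFDerivAt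
  have h2 := (((Complex.ofRealCLM.hasFDerivAt.comp y h1).const_mul a).cexp.mul_const b).fderiv
  have h3 : fderiv ℝ (Ψ ∘ (extChartAt 𝓘(ℝ, E) x).symm) y (invariantFrame x y v) = d :=
    (fderiv_comp_extChartAt_symm_invariantFrame hy hΨ v).trans hd
  have h4 : (fun z : E ↦ c ((extChartAt 𝓘(ℝ, E) x).symm z) * b) = fun z ↦
      Complex.exp (a * (Complex.ofRealCLM ∘ (Ψ ∘ (extChartAt 𝓘(ℝ, E) x).symm)) z) * b := by
    funext z
    rw [hc]
    rfl
  rw [h4, h2, hc]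
  simp only [smul_apply, ContinuousLinearMap.comp_apply, Complex.ofRealCLM_apply, smul_eq_mul,
    Function.comp_apply]
  rw [h3]
  ring

/-- On the invariant frame `τ` has the values of `σ 1` times an exponential. The invariant formula
for the exterior derivative thus becomes that exponential times the algebraic sum of
`sum_add_sum_bracket_of_typeZero`. -/
theorem ComplexForm.IsLeftInvariant.extDeriv_inChart_eq_zero [FiniteDimensional ℝ E]
    [CompleteSpace E] {m : ℕ} (hm : Module.finrank ℝ E = 2 * (m + 1))
    (J : GroupLieAlgebra 𝓘(ℝ, E) G →ₗ[ℝ] GroupLieAlgebra 𝓘(ℝ, E) G) (hJ : ∀ v, J (J v) = -v)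
    (hN : ∀ u v, ⁅u, v⁆ + J (⁅J u, v⁆ + ⁅u, J v⁆) - ⁅J u, J v⁆ = 0)
    {ψ : GroupLieAlgebra 𝓘(ℝ, E) G →ₗ[ℝ] ℝ}
    (hψ : ∀ v, ψ v = LinearMap.trace ℝ (GroupLieAlgebra 𝓘(ℝ, E) G)
        (J ∘ₗ LieAlgebra.ad ℝ (GroupLieAlgebra 𝓘(ℝ, E) G) v) -
      LinearMap.trace ℝ (GroupLieAlgebra 𝓘(ℝ, E) G)
        (LieAlgebra.ad ℝ (GroupLieAlgebra 𝓘(ℝ, E) G) (J v)))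
    {Ψ : G → ℝ} (hΨ : IsSmoothCharacter Ψ ψ) {σ τ : ComplexForm E G (m + 1)}
    (hσ : σ.IsLeftInvariant) (hσJ : ∀ (w : Fin (m + 1) → GroupLieAlgebra 𝓘(ℝ, E) G) j,
      σ 1 (Function.update w j (J (w j))) = Complex.I * σ 1 w)
    (hτ : ∀ g, τ g = Complex.exp (-(Complex.I / 2) * Ψ g) • σ g) {x : G} {y : E}
    (hy : y ∈ (extChartAt 𝓘(ℝ, E) x).target) : extDeriv (τ.inChart x) y = 0 := by
  have hsm : ContMDiff 𝓘(ℝ, E) 𝓘(ℝ, ℂ) ∞ (fun g ↦ Complex.exp (-(Complex.I / 2) * Ψ g)) :=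
    contMDiff_cexp_mul hΨ.contMDiff _
  let B : GroupLieAlgebra 𝓘(ℝ, E) G →ₗ[ℝ] E := (invariantFrame x y : E →ₗ[ℝ] E)
  let η : GroupLieAlgebra 𝓘(ℝ, E) G [⋀^Fin (m + 2)]→ₗ[ℝ] ℂ :=
    (extDeriv (τ.inChart x) y).toAlternatingMap.compLinearMap B
  have hη : η = 0 := by
    have : FiniteDimensional ℝ (GroupLieAlgebra 𝓘(ℝ, E) G) :=
      inferInstanceAs (FiniteDimensional ℝ E)
    refine AlternatingMap.eq_zero_of_forall_cons_cons J hJ hm η fun v u ↦ ?_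
    obtain ⟨w, hw⟩ : ∃ w : Fin (m + 2) → GroupLieAlgebra 𝓘(ℝ, E) G,
      w = Matrix.vecCons v (Matrix.vecCons (J v) u) := ⟨_, rfl⟩
    rw [← hw]
    have key := AlternatingMap.sum_add_sum_bracket_of_typeZero J (σ 1).toAlternatingMap hJ hm hN
      hσJ ψ hψ v u w hw
    have h1 := extDeriv_apply_vectorField (V := fun i (z : E) ↦ invariantFrame x z (w i))
      ((hσ.contDiffAt_inChart_smul hτ hsm hy).differentiableAt (by simp))
      (fun i ↦ (contDiffAt_invariantFrame_apply hy (w i)).differentiableAt (by simp))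
    refine h1.trans ?_
    have h2 : ∀ (i : Fin (m + 2)), fderiv ℝ (fun z : E ↦ τ.inChart x z
        (i.removeNth fun i ↦ invariantFrame x z (w i))) y (invariantFrame x y (w i)) =
          Complex.exp (-(Complex.I / 2) * Ψ ((extChartAt 𝓘(ℝ, E) x).symm y)) *
            (-(Complex.I / 2) * ψ (w i) * σ 1 (i.removeNth w)) := by
      intro i
      have h3 : (fun z : E ↦ τ.inChart x z (i.removeNth fun i ↦ invariantFrame x z (w i)))
          =ᶠ[nhds y] fun z ↦ Complex.exp (-(Complex.I / 2) * Ψ ((extChartAt 𝓘(ℝ, E) x).symm z)) *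
            σ 1 (i.removeNth w) := by
        filter_upwards [(isOpen_extChartAt_target x).mem_nhds hy] with z hz
        exact hσ.inChart_smul_invariantFrame hτ hz (i.removeNth w)
      rw [h3.fderiv_eq (𝕜 := ℝ)]
      exact fderiv_cexp_mul_invariantFrame (c := fun g ↦ Complex.exp (-(Complex.I / 2) * Ψ g))
        hy (hΨ.contMDiff.mdifferentiableAt (by simp)) (fun _ ↦ rfl) _ (w i) _
        (hΨ.mfderiv_eq _ _)
    have h4 : ∀ (i j : Fin (m + 1)), τ.inChart x y (Matrix.vecCons
        (lieBracket ℝ (fun z : E ↦ invariantFrame x z (w i.castSucc))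
          (fun z : E ↦ invariantFrame x z (w j.succ)) y)
        (j.removeNth (i.castSucc.removeNth fun i ↦ invariantFrame x y (w i)))) =
          Complex.exp (-(Complex.I / 2) * Ψ ((extChartAt 𝓘(ℝ, E) x).symm y)) *
            σ 1 (Matrix.vecCons ⁅w i.castSucc, w j.succ⁆
              (j.removeNth (i.castSucc.removeNth w))) := by
      intro i j
      rw [lieBracket_invariantFrame hy]
      refine Eq.trans (congrArg (τ.inChart x y) ?_) (hσ.inChart_smul_invariantFrame hτ hy _)
      ext k
      refine Fin.cases ?_ (fun k ↦ ?_) k <;> rfl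
    have h5 : ∀ (c : ℂ) (f : Fin (m + 2) → ℂ) (g : Fin (m + 1) → Fin (m + 1) → ℂ),
        ∑ i, (-1 : ℤ) ^ i.val • f i -
          ∑ i : Fin (m + 1), ∑ j ≥ i, (-1 : ℤ) ^ (i + j : ℕ) • g i j = 0 →
        ∑ i, (-1 : ℤ) ^ i.val • (c * f i) -
          ∑ i : Fin (m + 1), ∑ j ≥ i, (-1 : ℤ) ^ (i + j : ℕ) • (c * g i j) = 0 := by
      intro c f g h
      simp only [← mul_smul_comm, ← Finset.mul_sum, ← mul_sub, h, mul_zero]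
    simp only [h2, h4]
    exact h5 _ _ _ key
  ext w
  obtain ⟨v, rfl⟩ : ∃ v : Fin (m + 2) → E, w = fun i ↦ invariantFrame x y (v i) := by
    choose v hv using fun i ↦ (isInvertible_invariantFrame hy).bijective.2 (w i)
    exact ⟨v, funext fun i ↦ (hv i).symm⟩
  exact DFunLike.congr_fun hη v

end InvariantForms

/-! ### The complex structure on the Lie algebra -/

section ComplexStructure

variable {E : Type*} [NormedAddCommGroup E] [NormedSpace ℝ E]
  {G : Type*} [TopologicalSpace G] [ChartedSpace E G] [Group G] [LieGroup 𝓘(ℝ, E) ∞ G]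
  {J : ∀ g : G, TangentSpace 𝓘(ℝ, E) g →L[ℝ] TangentSpace 𝓘(ℝ, E) g}

theorem IsLeftInvariantComplexStructure.apply_mulInvariantVectorField
    (hJ : IsLeftInvariantComplexStructure J) (v : GroupLieAlgebra 𝓘(ℝ, E) G) (g : G) :
    J g (mulInvariantVectorField v g) = mulInvariantVectorField (J 1 v) g := by
  have h : ∀ g' : G, g' = g → ∀ w : E, (J g' w : E) = J g w := by rintro _ rfl w; rfl
  exact ((hJ.left_invariant g 1 v).trans (h _ (mul_one g) _)).symm

/-- `J` maps left invariant fields to left invariant fields, so integrability evaluated on them at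
`1` is this identity. -/
theorem IsLeftInvariantComplexStructure.nijenhuis_one [CompleteSpace E]
    (hJ : IsLeftInvariantComplexStructure J) (u v : GroupLieAlgebra 𝓘(ℝ, E) G) :
    ⁅u, v⁆ + J 1 (⁅(J 1 u : GroupLieAlgebra 𝓘(ℝ, E) G), v⁆ +
        ⁅u, (J 1 v : GroupLieAlgebra 𝓘(ℝ, E) G)⁆)
      - ⁅(J 1 u : GroupLieAlgebra 𝓘(ℝ, E) G), (J 1 v : GroupLieAlgebra 𝓘(ℝ, E) G)⁆ = 0 := by
  have h := hJ.integrable _ _ (contMDiff_infty_mulInvariantVectorField u)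
    (contMDiff_infty_mulInvariantVectorField v) 1
  have e : ∀ v : GroupLieAlgebra 𝓘(ℝ, E) G,
    (fun y ↦ J y (mulInvariantVectorField v y)) = mulInvariantVectorField (J 1 v) :=
      fun v ↦ funext fun y ↦ hJ.apply_mulInvariantVectorField v y
  rw [nijenhuis, e, e] at h
  exact h

end ComplexStructure

theorem Submodule.apply_ne_zero_of_isCompl_span_singleton_ker {K V : Type*} [Field K]
    [AddCommGroup V] [Module K V] {ψ : V →ₗ[K] K} (hψ : ψ ≠ 0) {e : V}
    (h : IsCompl (Submodule.span K {e}) ψ.ker) : ψ e ≠ 0 := by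
  intro he
  apply hψ
  have h1 : Submodule.span K {e} ≤ ψ.ker := by
    rw [Submodule.span_singleton_le_iff_mem]
    exact he
  rw [← LinearMap.ker_eq_top, ← sup_eq_right.2 h1, h.sup_eq_top]

theorem Submodule.exists_isCompl_span_singleton_ker {K V : Type*} [Field K]
    [AddCommGroup V] [Module K V] {ψ : V →ₗ[K] K} (hψ : ψ ≠ 0) :
    ∃ e : V, IsCompl (Submodule.span K {e}) ψ.ker := by
  obtain ⟨e, he⟩ : ∃ e, ψ e ≠ 0 := by
    by_contra! h
    exact hψ (LinearMap.ext h)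
  refine ⟨e, Submodule.disjoint_def.2 fun y hy hy' ↦ ?_,
    codisjoint_iff.2 (LinearMap.span_singleton_sup_ker_eq_top ψ he)⟩
  obtain ⟨c, rfl⟩ := Submodule.mem_span_singleton.1 hy
  rw [LinearMap.mem_ker, map_smul, smul_eq_mul, mul_eq_zero, or_iff_left he] at hy'
  rw [hy', zero_smul]

end

theorem mainTheorem6 {E : Type*} [NormedAddCommGroup E] [NormedSpace ℝ E] [FiniteDimensional ℝ E]
    [CompleteSpace E]
    {G : Type*} [TopologicalSpace G] [ChartedSpace E G] [Group G] [LieGroup 𝓘(ℝ, E) ∞ G]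
    [T2Space G] [SecondCountableTopology G] [SimplyConnectedSpace G] [Group.IsSolvable G]
    (n : ℕ) (hn : Module.finrank ℝ E = 2 * n)
    (hG : IsUnimodularLieGroup E G)
    (J : ∀ g : G, TangentSpace 𝓘(ℝ, E) g →L[ℝ] TangentSpace 𝓘(ℝ, E) g)
    (hJ : IsLeftInvariantComplexStructure J)
    (hψ_ne : canonicalForm (J 1) ≠ 0)
    (hψ : ∀ x y : GroupLieAlgebra 𝓘(ℝ, E) G, canonicalForm (J 1) ⁅x, y⁆ = 0) :
    -- the kernel of `ψ` is an ideal, and it has a complement `ℝ e₀`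
    (∀ x : GroupLieAlgebra 𝓘(ℝ, E) G, ∀ y ∈ (canonicalForm (J 1)).ker,
      ⁅x, y⁆ ∈ (canonicalForm (J 1)).ker) ∧
    (∃ e₀ : GroupLieAlgebra 𝓘(ℝ, E) G,
      IsCompl (Submodule.span ℝ {e₀}) (canonicalForm (J 1)).ker) ∧
    -- there is a unique connected normal subgroup `H` with `Lie(H) = ker ψ`
    (∃! H : Subgroup G, IsConnected (H : Set G) ∧ H.Normal ∧
      subgroupLieAlgebra E H = ((canonicalForm (J 1)).ker : Set (GroupLieAlgebra 𝓘(ℝ, E) G))) ∧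
    -- for this `H` and every such `e₀`
    ∀ H : Subgroup G, IsConnected (H : Set G) → H.Normal →
      subgroupLieAlgebra E H = ((canonicalForm (J 1)).ker : Set (GroupLieAlgebra 𝓘(ℝ, E) G)) →
      ∀ e₀ : GroupLieAlgebra 𝓘(ℝ, E) G,
        IsCompl (Submodule.span ℝ {e₀}) (canonicalForm (J 1)).ker →
        -- `G = ℝ ⋉ H`
        (∃ (γ : ℝ → G) (t : G → ℝ),
          IsOneParameterSubgroup γ e₀ ∧ IsSemidirectDecomposition E γ H t) ∧
        -- and `τ = exp(-(i/2) Tr(J ad e₀) t) σ` is a closed smooth `(n,0)`-form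
        ∀ (γ : ℝ → G) (t : G → ℝ),
          IsOneParameterSubgroup γ e₀ → IsSemidirectDecomposition E γ H t →
          ∀ σ : ComplexForm E G n, σ.IsLeftInvariant → σ.IsTypeZero J →
            ∀ τ : ComplexForm E G n,
              (∀ g : G, τ g =
                Complex.exp (-(Complex.I / 2) * (traceJad (J 1) e₀ : ℂ) * (t g : ℂ)) • σ g) →
              τ.IsSmooth ∧ τ.IsTypeZero J ∧ τ.extDerivative = 0 := by
  have : FiniteDimensional ℝ (GroupLieAlgebra 𝓘(ℝ, E) G) :=
    inferInstanceAs (FiniteDimensional ℝ E)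
  set ψ := canonicalForm (J 1) with hψ_def
  let ψE : E →ₗ[ℝ] ℝ := ψ
  obtain ⟨Ψ, h1, h2, h3⟩ := exists_character (G := G) (LinearMap.toContinuousLinearMap ψE) hψ
  have hΨ : IsSmoothCharacter Ψ ψ := ⟨h1, h2, h3⟩
  refine ⟨fun x y _ ↦ hψ x y, Submodule.exists_isCompl_span_singleton_ker hψ_ne,
    ⟨hΨ.kernel, ⟨hΨ.isConnected_kernel hψ_ne, hΨ.normal_kernel, hΨ.subgroupLieAlgebra_kernel⟩,
      fun H hH ↦ hΨ.eq_kernel hψ_ne hH.1 hH.2.1 hH.2.2⟩, fun H hc hN hH e he ↦ ?_⟩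
  have hH' := hΨ.eq_kernel hψ_ne hc hN hH
  subst hH'
  have he' := Submodule.apply_ne_zero_of_isCompl_span_singleton_ker hψ_ne he
  refine ⟨?_, fun γ t hγ ht σ hσ hσJ τ hτ ↦ ?_⟩
  · obtain ⟨γ, hγ⟩ := exists_isOneParameterSubgroup (E := E) (G := G) e
    exact ⟨γ, _, hγ, hΨ.isSemidirectDecomposition he' hγ⟩
  -- Unimodularity removes the second trace from `ψ`.
  have htr : traceJad (J 1) e = ψ e := by
    have := (canonicalForm_apply (J 1) e).2
    rw [hG, sub_zero] at this
    exact this.symm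
  have hτ' : ∀ g, τ g = Complex.exp (-(Complex.I / 2) * Ψ g) • σ g := fun g ↦ by
    rw [hτ, htr, mul_assoc, ← Complex.ofReal_mul, hΨ.coord_eq hγ ht]
  have hsm : ContMDiff 𝓘(ℝ, E) 𝓘(ℝ, ℂ) ∞
      (fun g ↦ Complex.exp (-(Complex.I / 2) * Ψ g)) :=
    contMDiff_cexp_mul hΨ.contMDiff _
  refine ⟨fun x ↦ hσ.contDiffAt_inChart_smul hτ' hsm (mem_extChartAt_target x), ?_, ?_⟩
  · intro x v j
    rw [hτ']
    refine (congrArg (_ * ·) (hσJ x v j)).trans ?_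
    exact mul_left_comm _ _ _
  -- In dimension zero `ψ` would vanish, so `n = m + 1`.
  · rcases n with _ | m
    · refine absurd ?_ hψ_ne
      rw [mul_zero] at hn
      have : Subsingleton (GroupLieAlgebra 𝓘(ℝ, E) G) :=
        Module.finrank_zero_iff (R := ℝ) (M := E) |>.1 hn
      exact LinearMap.ext fun v ↦ by rw [Subsingleton.elim v 0, map_zero, map_zero]
    · funext x
      have h0 := hσ.extDeriv_inChart_eq_zero hn (J 1 : GroupLieAlgebra 𝓘(ℝ, E) G →ₗ[ℝ] _)
        (hJ.sq_eq_neg 1) hJ.nijenhuis_one (fun v ↦ (canonicalForm_apply (J 1) v).2) hΨ (hσJ 1) hτ'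
        (mem_extChartAt_target x)
      rw [ComplexForm.extDerivative, h0]
      rfl
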